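/- Let $N=\mathbb{Z}^n$, $M=\operatorname{Hom}(N,\mathbb{Z})$, let $\Delta\subset M_{\mathbb{R}}$ be a reflexive polytope with dual $\Delta^*=\{v\mid\langle m,v\rangle\ge -1\ \forall m\in\Delta\}$, let $\Sigma=\operatorname{NF}(\Delta)$ be its normal fan (the fan over the faces of $\Delta^*$), $Y=\mathbb{P}(\Delta)$ and $S=\mathbb{C}[x_r\mid r\in\Sigma(1)]$ its Cox ring; write $\hat r$ for the minimal lattice generator of a ray $r$. Let $\Sigma(1)=J_1\cup\dots\cup J_c$ be a nef partition, i.e. a disjoint union such that all $E_j=\sum_{r\in J_j}D_r$ are Cartier and spanned by global sections. Let $\Delta_j$ be the convex hull of the lattice points $m\in M$ that are sections of $\mathcal{O}(E_j)$, $\nabla_j=\operatorname{convHull}(\{0\}\cup J_j)$, and let $\nabla\subset N_{\mathbb{R}}$ be the dual of $\operatorname{convHull}(\Delta_1\cup\dots\cup\Delta_c)$, with normal fan $\Sigma^\circ$, toric variety $Y^\circ=\mathbb{P}(\nabla)$ and Cox ring $S^\circ=\mathbb{C}[y_r\mid r\in\Sigma^\circ(1)]$. Degeneration. Put $m_j=\prod_{r\in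 J_j}x_r$, $I_0=\langle m_1,\dots,m_c\rangle\subset S$, and let $g_j\in S_{[E_j]}$ be a linear combination of the monomials of degree $[E_j]$ that do not lie in $I_0$; let $I=\langle t g_j+m_j\mid j=1,\dots,c\rangle\subset\mathbb{C}[t]\otimes S$. Special fiber tropical variety. Let $>$ be a monomial ordering on $\mathbb{C}[t]\otimes S$ that is local in $t$, and $>_w$ the weight ordering by $w=(w_t,w_x)\in\mathbb{R}\oplus\mathbb{R}^{\Sigma(1)}$ refined by $>$; weight vectors $w_x$ on the Cox variables have a class $\sum_r w_{x,r}\hat r\in N_{\mathbb{R}}$. Let $C_{I_0}(I)\subset\mathbb{R}\oplus N_{\mathbb{R}}$ be the closure of the set of all $-(w_t,[w_x])$ such that the lead ideal $L_{>_w}(I)$ is the ideal generated by $I_0$. Let $L$ be the field of Hahn series $\sum_{e\in\mathbb{R}}\alpha_e s^e$ over $\mathbb{C}$ (well-ordered support) with its valuation, and let the Bergman fan $BF(I)\subset\mathbb{R}\oplus N_{\mathbb{R}}$ be the set of all $(\operatorname{val}(t),\sum_r\operatorname{val}(x_r)\hat r)$ with $(t,x)\in V_L(I)$, all coordinates nonzero.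 Then $T_{I_0}(I)$ is the set of the nonempty polyhedra $\{w\in N_{\mathbb{R}}\mid(1,w)\in F\}$, where $F$ runs over the proper faces of $C_{I_0}(I)$ with $F\subset BF(I)$. Mirror strata. Let $J_j^\circ$ be the set of rays $r\in\Sigma^\circ(1)$ with $\min_{w\in\nabla_j}\langle\hat r,w\rangle=-1$ (so that $D_{\nabla_j}=\sum_{r\in J_j^\circ}D_r$), i.e. $\Sigma^\circ(1)=J_1^\circ\cup\dots\cup J_c^\circ$ is the Batyrev–Borisov dual nef partition, and $I_0^\circ=\langle\prod_{r\in J_j^\circ}y_r\mid j=1,\dots,c\rangle\subset S^\circ$. Let $\operatorname{Strata}_\nabla(I_0^\circ)$ be the set of nonempty proper faces of $\nabla$ whose toric stratum in $Y^\circ$, defined by the ideal $\langle y_r\mid F\subset F_r\rangle$ with $F_r$ the facet of $\nabla$ belonging to $r$, lies in the subscheme defined by $I_0^\circ$. Proposition. For general $g_1,\dots,g_c$ (coefficient vector outside the zero set of some nonzero polynomial that depends only on $\Delta$ and the partition) and for every monomial ordering $>$ as above, $$\operatorname{Strata}_\nabla(I_0^\circ)=T_{I_0}(I)$$ as sets of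 polyhedra in $N_{\mathbb{R}}$. -/

import Mathlib

/- Conventions: `N = M = ℤⁿ`, paired by the dot product, and `N_ℝ = M_ℝ = Fin n → ℝ`.
All index sets of the sums and products `∑ᶠ`, `∏ᶠ` below are finite whenever the polytope is
reflexive (rays of a complete fan, lattice points of a polytope). -/

noncomputable section

namespace TropMirror

/-- The lattice vector `v` as a real vector. -/
def toReal {n : ℕ} (v : Fin n → ℤ) : Fin n → ℝ := fun i => (v i : ℝ)

/-! ### Polytopes, faces, normal fans -/

/-- The dual `P^*` of a polytope containing `0`. -/
def polarDual {n : ℕ} (P : Set (Fin n → ℝ)) : Set (Fin n → ℝ) :=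
  {y | ∀ x ∈ P, -1 ≤ x ⬝ᵥ y}

/-- Integral polytopes: convex hulls of finitely many lattice points. -/
def IsLatticePolytope {n : ℕ} (P : Set (Fin n → ℝ)) : Prop :=
  ∃ V : Finset (Fin n → ℤ), P = convexHull ℝ (toReal '' (V : Set (Fin n → ℤ)))

structure IsReflexive {n : ℕ} (P : Set (Fin n → ℝ)) : Prop where
  lattice : IsLatticePolytope P
  lattice_dual : IsLatticePolytope (polarDual P)
  zero_mem : (0 : Fin n → ℝ) ∈ interior P
  zero_mem_dual : (0 : Fin n → ℝ) ∈ interior (polarDual P)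

/-- `F` is a face of the boundary complex of the polyhedron `P`: a nonempty face, cut out by a
supporting hyperplane, that is not all of `P`. -/
def IsProperFace {E : Type*} [AddCommGroup E] [Module ℝ E] [TopologicalSpace E]
    (P F : Set E) : Prop :=
  IsExposed ℝ P F ∧ F.Nonempty ∧ F ≠ P

/-- A lattice vector that is not a proper multiple of a lattice vector (in particular not `0`). -/
def IsPrimitive {n : ℕ} (v : Fin n → ℤ) : Prop :=
  ∀ (k : ℕ) (u : Fin n → ℤ), v = k • u → k = 1

/-- The rays `Σ(1)` of the normal fan `Σ = NF(Q)`, that is, of the fan over the faces of `Q^*`,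
each ray (the positive hull of a vertex of `Q^*`) being given by its minimal lattice generator. -/
def Ray {n : ℕ} (Q : Set (Fin n → ℝ)) : Type :=
  {v : Fin n → ℤ //
    IsPrimitive v ∧ ∃ a : ℝ, 0 < a ∧ a • toReal v ∈ (polarDual Q).extremePoints ℝ}

/-- The minimal lattice generator of a ray. -/
def Ray.gen {n : ℕ} {Q : Set (Fin n → ℝ)} (r : Ray Q) : Fin n → ℤ := r.val

/-- The face `F_r` of `Q` on which the ray generator `r` is minimal (a facet for a ray of
`NF(Q)`). -/
def facet {n : ℕ} (Q : Set (Fin n → ℝ)) (r : Ray Q) : Set (Fin n → ℝ) :=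
  {x ∈ Q | ∀ y ∈ Q, x ⬝ᵥ toReal r.gen ≤ y ⬝ᵥ toReal r.gen}

/-! ### Cox ring, strata -/

/-- The Cox ring `S = ℂ[x_r | r ∈ Σ(1)]` of the toric variety of the normal fan of `Q`. -/
abbrev Cox {n : ℕ} (Q : Set (Fin n → ℝ)) : Type := MvPolynomial (Ray Q) ℂ

/-- `ℂ[t] ⊗ S`; the variable with index `none` is `t`, the one with index `some r` is `x_r`. -/
abbrev CoxT {n : ℕ} (Q : Set (Fin n → ℝ)) : Type := MvPolynomial (Option (Ray Q)) ℂ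

/-- The inclusion `S → ℂ[t] ⊗ S`. -/
def incl {n : ℕ} (Q : Set (Fin n → ℝ)) : Cox Q →ₐ[ℂ] CoxT Q :=
  MvPolynomial.rename some

/-- The monomial `∏_{r ∈ J} x_r`. -/
def prodVars {n : ℕ} {Q : Set (Fin n → ℝ)} (J : Set (Ray Q)) : Cox Q :=
  ∏ᶠ r ∈ J, MvPolynomial.X r

/-- The ideal `⟨m_1, …, m_c⟩` with `m_j = ∏_{r ∈ J_j} x_r`. -/
def monomialIdeal {n c : ℕ} {Q : Set (Fin n → ℝ)} (J : Fin c → Set (Ray Q)) : Ideal (Cox Q) :=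
  Ideal.span (Set.range fun j => prodVars (J j))

/-- `Strata_Q(I₀)`: the faces `F` in the boundary complex of `Q` whose toric stratum, which is
defined by the ideal `⟨x_r | F ⊆ F_r⟩` of the Cox ring, lies in the subscheme defined by `I₀`. -/
def strata {n : ℕ} (Q : Set (Fin n → ℝ)) (I₀ : Ideal (Cox Q)) : Set (Set (Fin n → ℝ)) :=
  {F | IsProperFace Q F ∧ I₀ ≤ Ideal.span (MvPolynomial.X '' {r : Ray Q | F ⊆ facet Q r})}

/-! ### Torus invariant divisors `∑_r D r • D_r` -/

/-- The ray `r` lies in the maximal cone of `NF(Q)` belonging to the vertex `u` of `Q`. -/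
def InMaxCone {n : ℕ} {Q : Set (Fin n → ℝ)} (u : Fin n → ℝ) (r : Ray Q) : Prop :=
  ∀ x ∈ Q, u ⬝ᵥ toReal r.gen ≤ x ⬝ᵥ toReal r.gen

/-- `D` is Cartier: on the affine chart of each maximal cone it is the divisor of a character. -/
def IsCartier {n : ℕ} {Q : Set (Fin n → ℝ)} (D : Ray Q → ℤ) : Prop :=
  ∀ u ∈ Q.extremePoints ℝ, ∃ m : Fin n → ℤ, ∀ r : Ray Q, InMaxCone u r → m ⬝ᵥ r.gen = - D r

/-- The characters `m` that are global sections of `𝒪(D)`. -/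
def sections {n : ℕ} {Q : Set (Fin n → ℝ)} (D : Ray Q → ℤ) : Set (Fin n → ℤ) :=
  {m | ∀ r : Ray Q, 0 ≤ m ⬝ᵥ r.gen + D r}

/-- `𝒪(D)` is spanned by global sections: on the chart of each maximal cone some torus invariant
global section generates it. -/
def IsGloballyGenerated {n : ℕ} {Q : Set (Fin n → ℝ)} (D : Ray Q → ℤ) : Prop :=
  ∀ u ∈ Q.extremePoints ℝ, ∃ m ∈ sections D, ∀ r : Ray Q, InMaxCone u r → m ⬝ᵥ r.gen = - D r

/-- The polytope of sections `Δ_D`. -/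
def sectionPolytope {n : ℕ} {Q : Set (Fin n → ℝ)} (D : Ray Q → ℤ) : Set (Fin n → ℝ) :=
  convexHull ℝ (toReal '' sections D)

/-- The Cox monomial `∏_r x_r ^ (⟨m, r⟩ + D r)` of the section `m` of `𝒪(D)`. -/
def sectionMonomial {n : ℕ} {Q : Set (Fin n → ℝ)} (D : Ray Q → ℤ) (m : Fin n → ℤ) : Cox Q :=
  ∏ᶠ r : Ray Q, MvPolynomial.X r ^ (m ⬝ᵥ r.gen + D r).toNat

/-! ### Nef partitions and the Batyrev-Borisov mirror

A decomposition of `Σ(1)` into disjoint sets `J_1, …, J_c` is a map `part : Σ(1) → Fin c`. -/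

/-- `J_j`. -/
def block {n c : ℕ} {Q : Set (Fin n → ℝ)} (part : Ray Q → Fin c) (j : Fin c) : Set (Ray Q) :=
  {r | part r = j}

/-- `E_j = ∑_{r ∈ J_j} D_r`. -/
def blockDivisor {n c : ℕ} {Q : Set (Fin n → ℝ)} (part : Ray Q → Fin c) (j : Fin c) :
    Ray Q → ℤ :=
  fun r => if part r = j then 1 else 0

def IsNefPartition {n c : ℕ} {Q : Set (Fin n → ℝ)} (part : Ray Q → Fin c) : Prop :=
  ∀ j, IsCartier (blockDivisor part j) ∧ IsGloballyGenerated (blockDivisor part j)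

/-- `∇_j = convHull ({0} ∪ J_j)`. -/
def nablaPart {n c : ℕ} {Q : Set (Fin n → ℝ)} (part : Ray Q → Fin c) (j : Fin c) :
    Set (Fin n → ℝ) :=
  convexHull ℝ ({0} ∪ (fun r : Ray Q => toReal r.gen) '' block part j)

/-- `∇`, the polytope with `∇^* = convHull (Δ_1 ∪ … ∪ Δ_c)`. -/
def nabla {n c : ℕ} {Q : Set (Fin n → ℝ)} (part : Ray Q → Fin c) : Set (Fin n → ℝ) :=
  polarDual (convexHull ℝ (⋃ j, sectionPolytope (blockDivisor part j)))

/-- The block `J_j°` of the dual nef partition: the rays `r` of `NF(∇)` for which `D_r` occurs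
(with coefficient `- min_{w ∈ ∇_j} ⟨r, w⟩ = 1`) in the divisor `D_{∇_j}`. -/
def mirrorBlock {n c : ℕ} {Q : Set (Fin n → ℝ)} (part : Ray Q → Fin c) (j : Fin c) :
    Set (Ray (nabla part)) :=
  {r | IsLeast ((fun w => w ⬝ᵥ toReal r.gen) '' nablaPart part j) (-1)}

/-! ### The degeneration of a nef complete intersection -/

/-- `I₀ = ⟨m_1, …, m_c⟩`. -/
def specialIdeal {n c : ℕ} {Q : Set (Fin n → ℝ)} (part : Ray Q → Fin c) : Ideal (Cox Q) :=
  monomialIdeal (block part)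

/-- The lattice points of `Δ_j` whose Cox monomial is not in `I₀`. -/
def FreeSection {n c : ℕ} {Q : Set (Fin n → ℝ)} (part : Ray Q → Fin c) (j : Fin c) : Type :=
  {m : Fin n → ℤ // m ∈ sections (blockDivisor part j) ∧
    sectionMonomial (blockDivisor part j) m ∉ specialIdeal part}

/-- The index set of the coefficients of the sections `g_1, …, g_c`. -/
abbrev CoeffIndex {n c : ℕ} {Q : Set (Fin n → ℝ)} (part : Ray Q → Fin c) : Type :=
  Σ j : Fin c, FreeSection part j

/-- The section `g_j ∈ S_{[E_j]}` with coefficients `a`, not involving monomials in `I₀`. -/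
def genSection {n c : ℕ} {Q : Set (Fin n → ℝ)} (part : Ray Q → Fin c)
    (a : CoeffIndex part → ℂ) (j : Fin c) : Cox Q :=
  ∑ᶠ m : FreeSection part j, a ⟨j, m⟩ • sectionMonomial (blockDivisor part j) m.val

/-- `I = ⟨t g_j + m_j | j = 1, …, c⟩ ⊂ ℂ[t] ⊗ S`. -/
def familyIdeal {n c : ℕ} {Q : Set (Fin n → ℝ)} (part : Ray Q → Fin c)
    (a : CoeffIndex part → ℂ) : Ideal (CoxT Q) :=
  Ideal.span (Set.range fun j =>
    MvPolynomial.X none * incl Q (genSection part a j) + incl Q (prodVars (block part j)))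

/-! ### Special fiber Gröbner cone -/

/-- A monomial ordering (global, local or mixed): a total order on the monomials that is
compatible with multiplication. -/
structure MonomialOrdering (σ : Type) where
  lt : (σ →₀ ℕ) → (σ →₀ ℕ) → Prop
  strictTotal : IsStrictTotalOrder (σ →₀ ℕ) lt
  add_right : ∀ a b d : σ →₀ ℕ, lt a b → lt (a + d) (b + d)

/-- An ordering on `ℂ[t] ⊗ S` is local in `t` if `t < 1`. -/
def MonomialOrdering.IsLocalAt {σ : Type} (o : MonomialOrdering (Option σ)) : Prop :=
  o.lt (Finsupp.single none 1) 0

/-- The weight of a monomial. -/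
def weight {σ : Type} (w : σ → ℝ) (a : σ →₀ ℕ) : ℝ := a.sum fun i k => (k : ℝ) * w i

/-- The weight ordering by `w`, refined by `o`. -/
def weightLT {σ : Type} (w : σ → ℝ) (o : MonomialOrdering σ) (a b : σ →₀ ℕ) : Prop :=
  weight w a < weight w b ∨ (weight w a = weight w b ∧ o.lt a b)

/-- The lead ideal: generated by the largest monomials of the elements of `I`. -/
def leadIdeal {σ : Type} (lt : (σ →₀ ℕ) → (σ →₀ ℕ) → Prop) (I : Ideal (MvPolynomial σ ℂ)) :
    Ideal (MvPolynomial σ ℂ) :=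
  Ideal.span {p | ∃ f ∈ I, ∃ a ∈ f.support, (∀ b ∈ f.support, b ≠ a → lt b a) ∧
    p = MvPolynomial.monomial a 1}

/-- The class in `N_ℝ` of a weight vector on the Cox variables, under the isomorphism of
`Hom(ℝ^{Σ(1)}, ℝ) / Hom(A_{n-1}(Y) ⊗ ℝ, ℝ)` with `N_ℝ` that is dual to the inclusion
`M → ℤ^{Σ(1)}`, `m ↦ (⟨m, r⟩)_r`. -/
def weightClass {n : ℕ} {Q : Set (Fin n → ℝ)} (u : Ray Q → ℝ) : Fin n → ℝ :=
  ∑ᶠ r : Ray Q, u r • toReal r.gen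

/-- The Gröbner cone `C_{I₀}(I)` of special fiber weights, as a closed cone in `ℝ ⊕ N_ℝ`. The
ideal `I` being homogeneous for the Cox grading, the condition on `w` depends only on `w_t` and
on the class of `w_x` in `N_ℝ`. -/
def specialFiberCone {n : ℕ} {Q : Set (Fin n → ℝ)} (o : MonomialOrdering (Option (Ray Q)))
    (I : Ideal (CoxT Q)) (I₀ : Ideal (Cox Q)) : Set (ℝ × (Fin n → ℝ)) :=
  closure {p | ∃ w : Option (Ray Q) → ℝ,
    leadIdeal (weightLT w o) I = I₀.map (incl Q).toRingHom ∧
    p = -(w none, weightClass fun r => w (some r))}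

/-! ### Bergman fan and special fiber tropical variety -/

/-- The Bergman fan `BF(I) ⊂ ℝ ⊕ N_ℝ`: the image under the valuation of the points of `V(I)` with
nonzero coordinates in the field of Hahn series with exponents in `ℝ`. -/
def bergmanFan {n : ℕ} {Q : Set (Fin n → ℝ)} (I : Ideal (CoxT Q)) : Set (ℝ × (Fin n → ℝ)) :=
  {p | ∃ z : Option (Ray Q) → HahnSeries ℝ ℂ, (∀ i, z i ≠ 0) ∧
    (∀ f ∈ I, MvPolynomial.aeval z f = 0) ∧
    p = ((z none).order, weightClass fun r => (z (some r)).order)}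

/-- The special fiber tropical variety `T_{I₀}(I)`: the complex of the intersections with
`{w_t = 1}` of those faces in the boundary of `C_{I₀}(I)` that are tropical, i.e. contained in
`BF(I)`. -/
def specialFiberTropical {n : ℕ} {Q : Set (Fin n → ℝ)} (o : MonomialOrdering (Option (Ray Q)))
    (I : Ideal (CoxT Q)) (I₀ : Ideal (Cox Q)) : Set (Set (Fin n → ℝ)) :=
  {F | F.Nonempty ∧ ∃ C, IsProperFace (specialFiberCone o I I₀) C ∧ C ⊆ bergmanFan I ∧
    F = {w | ((1 : ℝ), w) ∈ C}}

end TropMirror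

end

noncomputable section

namespace TropMirror

/-! ### Lattice vectors and reflexive polytopes -/

/-! Coefficients are general as soon as all of them are nonzero. Call a section of `E_j` free if its
Cox monomial is not in `I₀`; these are the sections that occur in `g_j`.

Gröbner cone. The `m_j` have disjoint supports, so rewriting `m_j` as `-t g_j` gives a well-defined
`t`-adic normal form, and it vanishes on `I`. If every term of `t g_j` has smaller weight than
`m_j`, rewriting only lowers weights, so no lead monomial of `I` is irreducible and the lead ideal
is `I₀` (`leadIdeal_family`). Conversely, no term of `t g_j` lies in `I₀`, so a lead ideal `I₀`
forces `m_j` to lead. Hence the cone is `{t + ⟨m, w⟩ ≥ 0, m free}` (`specialFiberCone_eq`).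

Comparison with `∇`, which is `{⟨m, w⟩ ≥ -1, m any section}`. By nefness `w` lies in a cone of the
fan on which the support function `φ_j(w) = max (-⟨m, w⟩)` of every `E_j` is linear. If the free
inequalities hold at height 1 and one is tight in each block, then all `φ_j(w) = 1`: a non-free `m`
is divisible by some `m_k`, so `⟨m, w⟩ ≥ φ_k(w) - φ_j(w)`, which is too large for `m` to attain the
maximum. Such `w` (`IsTransversal`) lie in `∇`, and their tight sections are all free. So the
relevant faces of the cone, cut at height 1, are faces of `∇`, and conversely.

Tropical faces. At a point of the cone in the Bergman fan some term of `t g_j` must cancel `m_j`, so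
each block has a tight section. Conversely, at a transversal point each `J_j` contains a ray `ρ_j`
used with positive coefficient, and no tight section involves any `x_{ρ_i}`. The initial forms are
thus linear in the `x_{ρ_j}`, and a contraction over the Hahn series lifts a solution
(`mem_bergmanFan`).

Mirror strata. A face `F` of `∇` is a stratum iff each `J_j°` has a ray whose facet contains `F`.
The rays in `J_j°` are vertices of `∇^*` that are sections of `E_j`, and this amounts to some
section of each `E_j` being `-1` on `F` (`mem_strata_nabla`), the same condition as above. -/

theorem toReal_injective {n : ℕ} : Function.Injective (toReal (n := n)) := by
  intro u v h
  funext i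
  have := congrFun h i
  simp only [toReal] at this
  exact_mod_cast this

theorem toReal_dotProduct {n : ℕ} (u v : Fin n → ℤ) :
    toReal u ⬝ᵥ toReal v = ((u ⬝ᵥ v : ℤ) : ℝ) := by
  simp [toReal, dotProduct]

theorem toReal_zero {n : ℕ} : toReal (0 : Fin n → ℤ) = 0 := by
  funext i; simp [toReal]

theorem toReal_nsmul {n : ℕ} (k : ℕ) (u : Fin n → ℤ) : toReal (k • u) = (k : ℝ) • toReal u := by
  funext i; simp [toReal]

theorem IsPrimitive.ne_zero {n : ℕ} {v : Fin n → ℤ} (hv : IsPrimitive v) : v ≠ 0 := by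
  rintro rfl
  have := hv 2 0 (by simp)
  omega

/-- Bezout for primitive lattice vectors. -/
theorem IsPrimitive.exists_dotProduct_eq_one {n : ℕ} {v : Fin n → ℤ} (hv : IsPrimitive v) :
    ∃ b : Fin n → ℤ, b ⬝ᵥ v = 1 := by
  obtain ⟨d, hd⟩ := (IsPrincipalIdealRing.principal (Ideal.span (Set.range v))).principal
  have hdvd : ∀ i, d ∣ v i := fun i => by
    have : v i ∈ Ideal.span (Set.range v) := Ideal.subset_span ⟨i, rfl⟩
    rw [hd] at this
    exact Ideal.mem_span_singleton.1 this
  choose u hu using fun i => (Int.natAbs_dvd.2 (hdvd i))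
  have h1 : d.natAbs = 1 := hv d.natAbs u (by funext i; simp [hu i])
  have hmem : (1 : ℤ) ∈ Ideal.span (Set.range v) := by
    rw [hd]
    exact Ideal.mem_span_singleton.2 ((Int.isUnit_iff_natAbs_eq.2 h1).dvd)
  obtain ⟨b, hb⟩ := (Ideal.mem_span_range_iff_exists_fun).1 hmem
  exact ⟨b, by simpa [dotProduct] using hb⟩

theorem IsPrimitive.exists_nsmul_of_smul_eq {n : ℕ} {v m : Fin n → ℤ} (hv : IsPrimitive v)
    {a : ℝ} (ha : 0 < a) (h : a • toReal v = toReal m) :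
    ∃ k : ℕ, 0 < k ∧ a = k ∧ m = k • v := by
  obtain ⟨b, hb⟩ := hv.exists_dotProduct_eq_one
  have h2 : a = ((b ⬝ᵥ m : ℤ) : ℝ) := by
    rw [← toReal_dotProduct, ← h, dotProduct_smul, toReal_dotProduct, hb]
    simp
  have hpos : 0 < b ⬝ᵥ m := by
    rw [h2] at ha; exact_mod_cast ha
  obtain ⟨k, hk⟩ := Int.eq_ofNat_of_zero_le hpos.le
  have hak : a = (k : ℝ) := by rw [h2, hk]; simp
  refine ⟨k, by omega, hak, ?_⟩
  apply toReal_injective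
  rw [toReal_nsmul, ← h, hak]

theorem exists_pos_smul_mem {n : ℕ} {P : Set (Fin n → ℝ)}
    (hP : (0 : Fin n → ℝ) ∈ interior P) (y : Fin n → ℝ) :
    ∃ s : ℝ, 0 < s ∧ s • y ∈ P ∧ s • (-y) ∈ P := by
  have hc : ∀ z : Fin n → ℝ, ∀ᶠ s in nhdsWithin (0 : ℝ) (Set.Ioi 0), s • z ∈ P := fun z => by
    have : Filter.Tendsto (fun s : ℝ => s • z) (nhds 0) (nhds ((0 : ℝ) • z)) :=
      Continuous.tendsto (by fun_prop) 0
    rw [zero_smul] at this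
    exact (this.mono_left nhdsWithin_le_nhds).eventually (mem_interior_iff_mem_nhds.1 hP)
  obtain ⟨s, ⟨h1, h2⟩, h0⟩ := (((hc y).and (hc (-y))).and self_mem_nhdsWithin).exists
  exact ⟨s, h0, h1, h2⟩

/-- `P` contains a small negative multiple of `y`, whose pairing with `y` is a negative multiple of
`y ⬝ᵥ y`. -/
theorem eq_zero_of_nonneg_on {n : ℕ} {P : Set (Fin n → ℝ)} (hP : (0 : Fin n → ℝ) ∈ interior P)
    {y : Fin n → ℝ} (hy : ∀ x ∈ P, 0 ≤ x ⬝ᵥ y) : y = 0 := by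
  obtain ⟨s, hs0, -, hs⟩ := exists_pos_smul_mem hP y
  have h2 := hy _ hs
  rw [smul_dotProduct, neg_dotProduct, smul_eq_mul] at h2
  have h3 : 0 ≤ y ⬝ᵥ y := Finset.sum_nonneg fun i _ => mul_self_nonneg _
  exact dotProduct_self_eq_zero.1 (by nlinarith)

theorem zero_notMem_extremePoints {n : ℕ} {P : Set (Fin n → ℝ)}
    (hP : (0 : Fin n → ℝ) ∈ interior P) {w : Fin n → ℝ} (hw : w ≠ 0) :
    (0 : Fin n → ℝ) ∉ P.extremePoints ℝ := by
  intro h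
  obtain ⟨s, hs0, h1, h2⟩ := exists_pos_smul_mem hP w
  have h3 := h.2 h1 h2 ⟨1 / 2, 1 / 2, by norm_num, by norm_num, by norm_num, by
    rw [smul_neg, smul_neg, add_neg_cancel]⟩
  exact hw ((smul_eq_zero.1 h3).resolve_left hs0.ne')

theorem dotProduct_ge_on_convexHull {n : ℕ} {V : Set (Fin n → ℝ)} {y : Fin n → ℝ} {b : ℝ}
    (h : ∀ x ∈ V, b ≤ x ⬝ᵥ y) : ∀ x ∈ convexHull ℝ V, b ≤ x ⬝ᵥ y := by
  have hconv : Convex ℝ {x : Fin n → ℝ | b ≤ x ⬝ᵥ y} := by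
    apply convex_halfSpace_ge
    exact ⟨fun _ _ => add_dotProduct _ _ _, fun _ _ => smul_dotProduct _ _ _⟩
  exact fun x hx => convexHull_min h hconv hx

theorem IsLatticePolytope.isCompact {n : ℕ} {P : Set (Fin n → ℝ)} (hP : IsLatticePolytope P) :
    IsCompact P := by
  obtain ⟨V, rfl⟩ := hP
  exact (V.finite_toSet.image _).isCompact_convexHull ℝ

theorem IsLatticePolytope.convex {n : ℕ} {P : Set (Fin n → ℝ)} (hP : IsLatticePolytope P) :
    Convex ℝ P := by
  obtain ⟨V, rfl⟩ := hP
  exact convex_convexHull _ _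

theorem IsLatticePolytope.extremePoints_finite {n : ℕ} {P : Set (Fin n → ℝ)}
    (hP : IsLatticePolytope P) : (P.extremePoints ℝ).Finite := by
  obtain ⟨V, rfl⟩ := hP
  exact (V.finite_toSet.image _).subset extremePoints_convexHull_subset

theorem IsLatticePolytope.exists_of_extreme {n : ℕ} {P : Set (Fin n → ℝ)}
    (hP : IsLatticePolytope P) {x : Fin n → ℝ} (hx : x ∈ P.extremePoints ℝ) :
    ∃ m : Fin n → ℤ, toReal m = x := by
  obtain ⟨V, rfl⟩ := hP
  obtain ⟨m, -, hm⟩ := extremePoints_convexHull_subset hx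
  exact ⟨m, hm⟩

theorem IsLatticePolytope.convexHull_extremePoints {n : ℕ} {P : Set (Fin n → ℝ)}
    (hP : IsLatticePolytope P) : convexHull ℝ (P.extremePoints ℝ) = P := by
  have h := closure_convexHull_extremePoints hP.isCompact hP.convex
  rwa [(hP.extremePoints_finite.isClosed_convexHull ℝ).closure_eq] at h

/-- A nonzero lattice point of the dual of a reflexive polytope takes the value `-1`. -/
theorem IsReflexive.exists_dotProduct_eq_neg_one {n : ℕ} {Δ : Set (Fin n → ℝ)}
    (hΔ : IsReflexive Δ) {m : Fin n → ℤ} (hm : toReal m ∈ polarDual Δ) (hm0 : m ≠ 0) :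
    ∃ x : Fin n → ℤ, x ⬝ᵥ m = -1 := by
  by_contra! hne
  obtain ⟨V, hV⟩ := hΔ.lattice
  apply hm0
  apply toReal_injective
  rw [toReal_zero]
  -- By integrality, values that are at least `-1` and never `-1` on the lattice points spanning `Δ`
  -- are nonnegative there, hence on `Δ`.
  apply eq_zero_of_nonneg_on hΔ.zero_mem
  rw [hV]
  apply dotProduct_ge_on_convexHull
  rintro _ ⟨x, hx, rfl⟩
  have h1 := hm (toReal x) (by rw [hV]; exact subset_convexHull _ _ ⟨x, hx, rfl⟩)
  rw [toReal_dotProduct] at h1 ⊢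
  have h1' : -1 ≤ x ⬝ᵥ m := by exact_mod_cast h1
  have := hne x
  have h2 : 0 ≤ x ⬝ᵥ m := by omega
  exact_mod_cast h2

/-- The vertex on the ray is `k` times the generator and pairs to `-1` with some lattice vector, so
`k` divides `1`. Together with `IsReflexive.exists_ray` this identifies the rays with the vertices
of the dual polytope. -/
theorem IsReflexive.gen_mem_extremePoints {n : ℕ} {Δ : Set (Fin n → ℝ)} (hΔ : IsReflexive Δ)
    (r : Ray Δ) : toReal r.gen ∈ (polarDual Δ).extremePoints ℝ := by
  obtain ⟨hp, a, ha, hext⟩ := r.2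
  obtain ⟨m, hm⟩ := hΔ.lattice_dual.exists_of_extreme hext
  obtain ⟨k, hk, hak, hmk⟩ := hp.exists_nsmul_of_smul_eq ha hm.symm
  have hm0 : m ≠ 0 := by
    rw [hmk]
    exact smul_ne_zero hk.ne' hp.ne_zero
  obtain ⟨x, hx⟩ := hΔ.exists_dotProduct_eq_neg_one (by rw [hm]; exact hext.1) hm0
  rw [hmk, dotProduct_smul, nsmul_eq_mul] at hx
  have h1 : k = 1 := by
    have : (k : ℤ) ∣ 1 := ⟨-(x ⬝ᵥ r.1), by linarith⟩
    exact_mod_cast Int.eq_one_of_dvd_one (by positivity) this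
  rw [hak, h1, Nat.cast_one, one_smul] at hext
  exact hext

theorem IsReflexive.exists_ray {n : ℕ} {Δ : Set (Fin n → ℝ)} (hΔ : IsReflexive Δ)
    {x : Fin n → ℝ} (hx : x ∈ (polarDual Δ).extremePoints ℝ) (hx0 : x ≠ 0) :
    ∃ r : Ray Δ, toReal r.gen = x := by
  obtain ⟨m, rfl⟩ := hΔ.lattice_dual.exists_of_extreme hx
  have hm0 : m ≠ 0 := by rintro rfl; exact hx0 toReal_zero
  refine ⟨⟨m, fun k u hk => ?_, 1, one_pos, by rwa [one_smul]⟩, rfl⟩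
  obtain ⟨y, hy⟩ := hΔ.exists_dotProduct_eq_neg_one hx.1 hm0
  rw [hk, dotProduct_smul, nsmul_eq_mul] at hy
  have : (k : ℤ) ∣ 1 := ⟨-(y ⬝ᵥ u), by linarith⟩
  exact_mod_cast Int.eq_one_of_dvd_one (by positivity) this

theorem IsReflexive.finite_ray {n : ℕ} {Δ : Set (Fin n → ℝ)} (hΔ : IsReflexive Δ) :
    Finite (Ray Δ) := by
  have := hΔ.lattice_dual.extremePoints_finite.to_subtype
  refine Finite.of_injective
    (fun r : Ray Δ => (⟨_, hΔ.gen_mem_extremePoints r⟩ : (polarDual Δ).extremePoints ℝ)) ?_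
  intro r s h
  exact Subtype.ext (toReal_injective (Subtype.ext_iff.1 h))

/-! ### Nef partitions and conical combinations of rays -/

/-- Every vector lies in a maximal cone of the normal fan of a reflexive polytope. -/
theorem IsReflexive.exists_cone {n : ℕ} {Δ : Set (Fin n → ℝ)} (hΔ : IsReflexive Δ)
    [Fintype (Ray Δ)] {w : Fin n → ℝ} (hw : w ≠ 0) :
    ∃ u ∈ Δ.extremePoints ℝ, ∃ l : Ray Δ → ℝ, (∀ r, 0 ≤ l r) ∧
      ∑ r, l r • toReal r.gen = w ∧ ∀ r, l r ≠ 0 → InMaxCone u r := by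
  have hne : Δ.Nonempty := ⟨0, interior_subset hΔ.zero_mem⟩
  obtain ⟨x₀, hx₀, hmin⟩ := hΔ.lattice.isCompact.exists_isMinOn (f := fun x => x ⬝ᵥ w) hne
    (Continuous.continuousOn (by unfold dotProduct; fun_prop))
  have hexp : IsExtreme ℝ Δ {x ∈ Δ | x ⬝ᵥ w = x₀ ⬝ᵥ w} := by
    refine ⟨fun x hx => hx.1, ?_⟩
    rintro x hx y hy z ⟨-, hz⟩ ⟨a, b, ha, hb, hab, rfl⟩
    refine ⟨hx, ?_⟩
    have h1 : x₀ ⬝ᵥ w ≤ x ⬝ᵥ w := hmin hx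
    have h2 : x₀ ⬝ᵥ w ≤ y ⬝ᵥ w := hmin hy
    rw [add_dotProduct, smul_dotProduct, smul_dotProduct, smul_eq_mul, smul_eq_mul] at hz
    have h3 : a * (x ⬝ᵥ w - x₀ ⬝ᵥ w) ≤ 0 := by
      have : b = 1 - a := by linarith
      subst this
      nlinarith
    nlinarith
  have hcomp : IsCompact {x ∈ Δ | x ⬝ᵥ w = x₀ ⬝ᵥ w} :=
    hΔ.lattice.isCompact.inter_right
      (isClosed_eq (by unfold dotProduct; fun_prop) continuous_const)
  -- The maximal cone containing `w` belongs to any vertex `u` of the face of `Δ` on which `w` is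
  -- minimal; `w` is then scaled into the facet of the dual polytope cut out by `u`.
  obtain ⟨u, hu⟩ := hcomp.extremePoints_nonempty ⟨x₀, hx₀, rfl⟩
  have huw : ∀ x ∈ Δ, u ⬝ᵥ w ≤ x ⬝ᵥ w := fun x hx => by rw [hu.1.2]; exact hmin hx
  have hext := hexp.extremePoints_subset_extremePoints hu
  set h := -(u ⬝ᵥ w) with hh
  have hpos : 0 < h := by
    by_contra! hle
    exact hw (eq_zero_of_nonneg_on hΔ.zero_mem fun x hx => by linarith [huw x hx])
  have hmem : h⁻¹ • w ∈ polarDual Δ := by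
    intro x hx
    rw [dotProduct_smul, smul_eq_mul]
    have := huw x hx
    rw [inv_mul_eq_div, le_div_iff₀ hpos]
    linarith
  rw [← hΔ.lattice_dual.convexHull_extremePoints] at hmem
  have hsub : convexHull ℝ ((polarDual Δ).extremePoints ℝ) ⊆
      (fun l : Ray Δ → ℝ => ∑ r, l r • toReal r.gen) '' stdSimplex ℝ (Ray Δ) := by
    refine convexHull_min ?_ ((convex_stdSimplex ℝ (Ray Δ)).is_linear_image ?_)
    · intro x hx
      have hx0 : x ≠ 0 := by
        rintro rfl
        exact zero_notMem_extremePoints hΔ.zero_mem_dual hw hx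
      classical
      obtain ⟨r, hr⟩ := hΔ.exists_ray hx hx0
      refine ⟨Pi.single r 1, single_mem_stdSimplex ℝ r, ?_⟩
      simp [Pi.single_apply, ite_smul, hr]
    · refine ⟨fun l l' => ?_, fun a l => ?_⟩
      · simp [add_smul, Finset.sum_add_distrib]
      · simp [Finset.smul_sum, mul_smul]
  obtain ⟨l, ⟨hl0, hl1⟩, hlw⟩ := hsub hmem
  simp only at hlw
  have huge : ∀ r : Ray Δ, -1 ≤ u ⬝ᵥ toReal r.gen := fun r =>
    (hΔ.gen_mem_extremePoints r).1 u hext.1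
  -- A convex combination of values `≥ -1` equals `-1`, so only rays pairing to `-1` with `u` occur;
  -- these are the rays of the cone of `u`.
  have hzero : ∑ r, l r * (u ⬝ᵥ toReal r.gen + 1) = 0 := by
    have h1 : u ⬝ᵥ (∑ r, l r • toReal r.gen) = -1 := by
      rw [hlw, dotProduct_smul, smul_eq_mul, inv_mul_eq_div, div_eq_iff hpos.ne']
      linarith
    simp only [dotProduct_sum, dotProduct_smul, smul_eq_mul] at h1
    simp only [mul_add, Finset.sum_add_distrib, mul_one, h1, hl1]
    norm_num
  rw [Finset.sum_eq_zero_iff_of_nonneg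
    (fun r _ => mul_nonneg (hl0 r) (by linarith [huge r]))] at hzero
  refine ⟨u, hext, fun r => h * l r, fun r => mul_nonneg hpos.le (hl0 r), ?_, fun r hr x hx => ?_⟩
  · simp only [mul_smul, ← Finset.smul_sum, hlw]
    rw [smul_smul, mul_inv_cancel₀ hpos.ne', one_smul]
  · have h1 : l r ≠ 0 := right_ne_zero_of_mul hr
    have h2 : u ⬝ᵥ toReal r.gen + 1 = 0 := by
      simpa [h1] using hzero r (Finset.mem_univ r)
    linarith [(hΔ.gen_mem_extremePoints r).1 x hx]

theorem zero_mem_sections_blockDivisor {n c : ℕ} {Q : Set (Fin n → ℝ)} (part : Ray Q → Fin c)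
    (j : Fin c) : (0 : Fin n → ℤ) ∈ sections (blockDivisor part j) := by
  intro r
  rw [zero_dotProduct, blockDivisor]
  split_ifs <;> norm_num

/-- The value at `∑ r, l r • r` of the support function of `E_j`, when the rays `r` with
`l r ≠ 0` span a cone of the fan. -/
def blockMass {n c : ℕ} {Q : Set (Fin n → ℝ)} [Fintype (Ray Q)] (part : Ray Q → Fin c)
    (l : Ray Q → ℝ) (j : Fin c) : ℝ :=
  ∑ r, l r * (blockDivisor part j r : ℝ)

theorem dotProduct_conic {n : ℕ} {Q : Set (Fin n → ℝ)} [Fintype (Ray Q)] (m : Fin n → ℤ)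
    (l : Ray Q → ℝ) :
    toReal m ⬝ᵥ (∑ r, l r • toReal r.gen) = ∑ r, l r * ((m ⬝ᵥ r.gen : ℤ) : ℝ) := by
  simp only [dotProduct_sum, dotProduct_smul, smul_eq_mul, toReal_dotProduct]

theorem dotProduct_add_blockMass {n c : ℕ} {Q : Set (Fin n → ℝ)} [Fintype (Ray Q)]
    (part : Ray Q → Fin c) (m : Fin n → ℤ) (l : Ray Q → ℝ) (j : Fin c) :
    toReal m ⬝ᵥ (∑ r, l r • toReal r.gen) + blockMass part l j =
      ∑ r, l r * ((m ⬝ᵥ r.gen + blockDivisor part j r : ℤ) : ℝ) := by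
  rw [dotProduct_conic, blockMass, ← Finset.sum_add_distrib]
  exact Finset.sum_congr rfl fun r _ => by push_cast; ring

/-- The inequalities defining a section, summed with the nonnegative coefficients `l`. With the
equality in `exists_conic`, the block mass is the maximum of `-⟨m, w⟩` over the sections. -/
theorem neg_blockMass_le {n c : ℕ} {Q : Set (Fin n → ℝ)} [Fintype (Ray Q)]
    {part : Ray Q → Fin c} {j : Fin c} {m : Fin n → ℤ} (hm : m ∈ sections (blockDivisor part j))
    {l : Ray Q → ℝ} (hl : ∀ r, 0 ≤ l r) :
    -blockMass part l j ≤ toReal m ⬝ᵥ (∑ r, l r • toReal r.gen) := by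
  have := dotProduct_add_blockMass part m l j
  have h2 : 0 ≤ ∑ r, l r * ((m ⬝ᵥ r.gen + blockDivisor part j r : ℤ) : ℝ) :=
    Finset.sum_nonneg fun r _ => mul_nonneg (hl r) (by exact_mod_cast hm r)
  linarith

/-- Every vector is a conical combination of rays on which the support functions of the `E_j`
are linear. -/
theorem exists_conic {n c : ℕ} {Δ : Set (Fin n → ℝ)} (hΔ : IsReflexive Δ) [Fintype (Ray Δ)]
    {part : Ray Δ → Fin c} (hpart : IsNefPartition part) (w : Fin n → ℝ) :
    ∃ l : Ray Δ → ℝ, (∀ r, 0 ≤ l r) ∧ ∑ r, l r • toReal r.gen = w ∧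
      ∀ j, ∃ m ∈ sections (blockDivisor part j), toReal m ⬝ᵥ w = -blockMass part l j := by
  by_cases hw : w = 0
  · refine ⟨0, fun r => le_rfl, by simp [hw], fun j =>
      ⟨0, zero_mem_sections_blockDivisor part j, by simp [hw, blockMass]⟩⟩
  obtain ⟨u, hu, l, hl, hsum, hcone⟩ := hΔ.exists_cone hw
  refine ⟨l, hl, hsum, fun j => ?_⟩
  obtain ⟨m, hm, hmr⟩ := (hpart j).2 u hu
  refine ⟨m, hm, ?_⟩
  rw [← hsum, eq_neg_iff_add_eq_zero, dotProduct_add_blockMass]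
  refine Finset.sum_eq_zero fun r _ => ?_
  by_cases hr : l r = 0
  · simp [hr]
  · rw [hmr r (hcone r hr), neg_add_cancel, Int.cast_zero, mul_zero]

/-- Every linear form is bounded below on the sections by minus a block mass; applying this to plus
and minus the coordinate forms encloses them in a box. -/
theorem finite_sections {n c : ℕ} {Δ : Set (Fin n → ℝ)} (hΔ : IsReflexive Δ)
    {part : Ray Δ → Fin c} (hpart : IsNefPartition part) (j : Fin c) :
    (sections (blockDivisor part j)).Finite := by
  have := hΔ.finite_ray
  have := Fintype.ofFinite (Ray Δ)
  have hb : ∀ w : Fin n → ℝ, ∃ B : ℤ, ∀ m ∈ sections (blockDivisor part j),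
      -(B : ℝ) ≤ toReal m ⬝ᵥ w := fun w => by
    obtain ⟨l, hl, rfl, -⟩ := exists_conic hΔ hpart w
    obtain ⟨B, hB⟩ := exists_int_gt (blockMass part l j)
    exact ⟨B, fun m hm => by linarith [neg_blockMass_le hm hl]⟩
  choose lo hlo using fun i : Fin n => hb (Pi.single i 1)
  choose hi hhi using fun i : Fin n => hb (-Pi.single i 1)
  refine (Set.finite_Icc (fun i => -lo i) (fun i => hi i)).subset fun m hm => ⟨fun i => ?_, fun i => ?_⟩
  · have := hlo i m hm
    rw [dotProduct_single, mul_one] at this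
    simp only [toReal] at this
    exact_mod_cast this
  · have := hhi i m hm
    rw [dotProduct_neg, dotProduct_single, mul_one] at this
    simp only [toReal] at this
    have h2 : (m i : ℝ) ≤ hi i := by linarith
    exact_mod_cast h2

/-! ### Faces of polyhedra given by linear inequalities -/

section Polyhedra

variable {E : Type*} [AddCommGroup E] [Module ℝ E] [TopologicalSpace E]

/-- The polyhedron `{x | b i ≤ ℓ i x}`. -/
def polyhedron {ι : Type*} (ℓ : ι → StrongDual ℝ E) (b : ι → ℝ) : Set E :=
  {x | ∀ i, b i ≤ ℓ i x}

/-- The points of a polyhedron at which the inequalities with indices in `T` are equalities. -/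
def tightFace {ι : Type*} (ℓ : ι → StrongDual ℝ E) (b : ι → ℝ) (T : Set ι) : Set E :=
  {x ∈ polyhedron ℓ b | ∀ i ∈ T, ℓ i x = b i}

/-- The sum of the forms with index in `T` attains the lower bound `∑ b i` exactly where every
summand does. -/
theorem isExposed_tightFace {ι : Type*} [Finite ι] [ContinuousAdd E] (ℓ : ι → StrongDual ℝ E)
    (b : ι → ℝ) (T : Set ι) : IsExposed ℝ (polyhedron ℓ b) (tightFace ℓ b T) := by
  classical
  have := Fintype.ofFinite ι
  rintro ⟨x₁, hx₁, hT₁⟩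
  refine ⟨-∑ i ∈ T.toFinset, ℓ i, ?_⟩
  ext x
  have hval : ∀ y, (-∑ i ∈ T.toFinset, ℓ i) y = -∑ i ∈ T.toFinset, ℓ i y := fun y => by
    simp
  simp only [hval, neg_le_neg_iff]
  constructor
  · rintro ⟨hx, hT⟩
    refine ⟨hx, fun y hy => Finset.sum_le_sum fun i hi => ?_⟩
    rw [hT i (Set.mem_toFinset.1 hi)]
    exact hy i
  · rintro ⟨hx, hmax⟩
    refine ⟨hx, fun i hi => ?_⟩
    have h1 := hmax x₁ hx₁
    have h2 : ∑ i ∈ T.toFinset, ℓ i x₁ = ∑ i ∈ T.toFinset, b i :=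
      Finset.sum_congr rfl fun i hi => hT₁ i (Set.mem_toFinset.1 hi)
    have h3 : ∑ i ∈ T.toFinset, b i ≤ ∑ i ∈ T.toFinset, ℓ i x :=
      Finset.sum_le_sum fun i _ => hx i
    exact ((Finset.sum_eq_sum_iff_of_le fun i _ => hx i).1
      (le_antisymm h3 (h1.trans_eq h2)) i (Set.mem_toFinset.2 hi)).symm

/-- A nonempty exposed face is cut out by the inequalities that are equalities at a suitable
point of it. -/
theorem exists_eq_tightFace {ι : Type*} [Finite ι] {ℓ : ι → StrongDual ℝ E} {b : ι → ℝ}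
    {F : Set E} (hF : IsExposed ℝ (polyhedron ℓ b) F) (hne : F.Nonempty) :
    ∃ x₀ ∈ F, F = tightFace ℓ b {i | ℓ i x₀ = b i} := by
  classical
  have := Fintype.ofFinite ι
  obtain ⟨l, hl⟩ := hF hne
  have hsub : F ⊆ polyhedron ℓ b := hF.subset
  -- Averaging with points where further inequalities are strict produces a relative interior point:
  -- only inequalities tight on all of `F` remain tight there.
  have hrel : ∀ S : Finset ι, ∃ x ∈ F, ∀ i ∈ S, ℓ i x = b i → ∀ y ∈ F, ℓ i y = b i := by
    intro S
    induction S using Finset.induction_on with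
    | empty => exact ⟨hne.some, hne.some_mem, by simp⟩
    | insert i S _ ih =>
      obtain ⟨x, hx, hxS⟩ := ih
      by_cases h : ∀ y ∈ F, ℓ i y = b i
      · refine ⟨x, hx, fun k hk hkx => ?_⟩
        rcases Finset.mem_insert.1 hk with rfl | hk
        · exact h
        · exact hxS k hk hkx
      push Not at h
      obtain ⟨y, hy, hyi⟩ := h
      have hmid : ∀ f : StrongDual ℝ E,
          f ((1 / 2 : ℝ) • x + (1 / 2 : ℝ) • y) = (1 / 2) * f x + (1 / 2) * f y := fun f => by
        simp
      refine ⟨(1 / 2 : ℝ) • x + (1 / 2 : ℝ) • y, ?_, fun k hk hkx => ?_⟩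
      · rw [hl] at hx hy ⊢
        refine ⟨fun k => ?_, fun z hz => ?_⟩
        · rw [hmid]; linarith [hx.1 k, hy.1 k]
        · rw [hmid]; linarith [hx.2 z hz, hy.2 z hz]
      · rw [hmid] at hkx
        have h1 := hsub hx k
        have h2 := hsub hy k
        rcases Finset.mem_insert.1 hk with rfl | hk
        · exact absurd (by linarith) hyi
        · exact hxS k hk (by linarith)
  obtain ⟨x₀, hx₀, htight⟩ := hrel Finset.univ
  refine ⟨x₀, hx₀, Set.Subset.antisymm
    (fun y hy => ⟨hsub hy, fun i hi => htight i (Finset.mem_univ i) hi y hy⟩) ?_⟩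
  rintro y ⟨hy, hyt⟩
  -- From `x₀` the segment from `y` can be prolonged a little beyond `x₀` inside the polyhedron. As
  -- `l` is maximal at `x₀`, it cannot be smaller at `y`.
  have hev : ∀ i, ∀ᶠ s in nhdsWithin (0 : ℝ) (Set.Ioi 0),
      b i ≤ ℓ i x₀ - s * (ℓ i y - ℓ i x₀) := fun i => by
    by_cases hi : ℓ i x₀ = b i
    · exact Filter.Eventually.of_forall fun s => by rw [hyt i hi, hi]; simp
    · have hlt : b i < ℓ i x₀ - 0 * (ℓ i y - ℓ i x₀) := by
        rw [zero_mul, sub_zero]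
        exact lt_of_le_of_ne (hsub hx₀ i) (Ne.symm hi)
      have hc : Filter.Tendsto (fun s : ℝ => ℓ i x₀ - s * (ℓ i y - ℓ i x₀)) (nhds 0)
          (nhds (ℓ i x₀ - 0 * (ℓ i y - ℓ i x₀))) := Continuous.tendsto (by fun_prop) 0
      exact ((hc.mono_left nhdsWithin_le_nhds).eventually (lt_mem_nhds hlt)).mono
        fun s hs => hs.le
  obtain ⟨s, hs, hs0⟩ := ((Filter.eventually_all.2 hev).and self_mem_nhdsWithin).exists
  have hs0' : 0 < s := hs0
  have hval : ∀ f : StrongDual ℝ E, f (x₀ - s • (y - x₀)) = f x₀ - s * (f y - f x₀) := fun f => by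
    simp
  have hz : x₀ - s • (y - x₀) ∈ polyhedron ℓ b := fun i => by rw [hval]; exact hs i
  have hx₀' := hx₀
  rw [hl] at hx₀' ⊢
  have h1 := hx₀'.2 _ hz
  rw [hval] at h1
  have h2 : l x₀ ≤ l y := by
    have : 0 ≤ s * (l y - l x₀) := by linarith
    linarith [nonneg_of_mul_nonneg_right this hs0']
  exact ⟨hy, fun z hz => (hx₀'.2 z hz).trans h2⟩

end Polyhedra

open MvPolynomial

/-! ### Normal forms for the family `t g_j + m_j` -/

section NormalForm

variable {σ ι : Type}

open Classical in
/-- The coefficient of `t ^ b` in the `t`-adic normal form modulo the relations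
`x ^ ν j = - t * g j`. -/
def normalForm (ν : ι → σ →₀ ℕ) (g : ι → MvPolynomial σ ℂ) :
    ℕ → MvPolynomial σ ℂ →ₗ[ℂ] MvPolynomial σ ℂ
  | 0 => (basisMonomials σ ℂ).constr ℂ fun a => if ∃ j, ν j ≤ a then 0 else monomial a 1
  | b + 1 => (basisMonomials σ ℂ).constr ℂ fun a =>
      -- The applicable relation is picked arbitrarily; `normalForm_succ_mul` shows that the choice
      -- does not matter when the `ν j` are disjoint.
      if h : ∃ j, ν j ≤ a then
        -normalForm ν g b (g h.choose * monomial (a - ν h.choose) 1) else 0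

theorem basisMonomials_constr_monomial {τ M : Type*} [AddCommGroup M] [Module ℂ M]
    (f : (τ →₀ ℕ) → M) (a : τ →₀ ℕ) :
    (basisMonomials τ ℂ).constr ℂ f (monomial a 1) = f a :=
  Module.Basis.constr_basis (basisMonomials τ ℂ) ℂ f a

theorem monomial_eq_smul_monomial_one {τ : Type*} (a : τ →₀ ℕ) (c : ℂ) :
    monomial a c = c • monomial a (1 : ℂ) := by
  rw [smul_monomial, smul_eq_mul, mul_one]

theorem map_monomial_eq_smul {τ M : Type*} [AddCommGroup M] [Module ℂ M]
    (L : MvPolynomial τ ℂ →ₗ[ℂ] M) (a : τ →₀ ℕ) (c : ℂ) :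
    L (monomial a c) = c • L (monomial a 1) := by
  rw [← map_smul, ← monomial_eq_smul_monomial_one]

theorem normalForm_zero_of_le (ν : ι → σ →₀ ℕ) (g : ι → MvPolynomial σ ℂ) {a : σ →₀ ℕ} {j : ι}
    (h : ν j ≤ a) : normalForm ν g 0 (monomial a 1) = 0 := by
  rw [normalForm, basisMonomials_constr_monomial, if_pos ⟨j, h⟩]

theorem normalForm_zero_of_not_le (ν : ι → σ →₀ ℕ) (g : ι → MvPolynomial σ ℂ) {a : σ →₀ ℕ}
    (h : ∀ j, ¬ ν j ≤ a) : normalForm ν g 0 (monomial a 1) = monomial a 1 := by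
  rw [normalForm, basisMonomials_constr_monomial, if_neg (by simpa using h)]

theorem normalForm_succ_of_not_le (ν : ι → σ →₀ ℕ) (g : ι → MvPolynomial σ ℂ) (b : ℕ)
    {a : σ →₀ ℕ} (h : ∀ j, ¬ ν j ≤ a) : normalForm ν g (b + 1) (monomial a 1) = 0 := by
  rw [normalForm, basisMonomials_constr_monomial, dif_neg (by simpa using h)]

theorem exists_normalForm_succ (ν : ι → σ →₀ ℕ) (g : ι → MvPolynomial σ ℂ)
    {a : σ →₀ ℕ} {j : ι} (h : ν j ≤ a) : ∃ k, ν k ≤ a ∧ ∀ b,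
      normalForm ν g (b + 1) (monomial a 1) =
        -normalForm ν g b (g k * monomial (a - ν k) 1) := by
  have hex : ∃ j, ν j ≤ a := ⟨j, h⟩
  refine ⟨hex.choose, hex.choose_spec, fun b => ?_⟩
  conv_lhs => rw [normalForm, basisMonomials_constr_monomial, dif_pos hex]

theorem normalForm_zero_mul (ν : ι → σ →₀ ℕ) (g : ι → MvPolynomial σ ℂ) (j : ι)
    (p : MvPolynomial σ ℂ) : normalForm ν g 0 (p * monomial (ν j) 1) = 0 := by
  induction p using MvPolynomial.induction_on' with
  | monomial u c =>
    rw [monomial_mul, map_monomial_eq_smul,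
      normalForm_zero_of_le ν g (j := j) (le_add_of_nonneg_left zero_le), smul_zero]
  | add p q hp hq => rw [add_mul, map_add, hp, hq, add_zero]

/-- The normal form is compatible with all relations. -/
theorem normalForm_succ_mul {ν : ι → σ →₀ ℕ} (hν : ∀ i j, i ≠ j → Disjoint (ν i) (ν j))
    (g : ι → MvPolynomial σ ℂ) (b : ℕ) (j : ι) (p : MvPolynomial σ ℂ) :
    normalForm ν g (b + 1) (p * monomial (ν j) 1) = -normalForm ν g b (p * g j) := by
  -- Passage from level `b` to `b + 1`. The two alternatives are what is known at level `b`: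
  -- multiples of the relations die if `b = 0`, and are rewritten if `b > 0`.
  have hmon : ∀ b : ℕ, (∀ k p, normalForm ν g b (p * monomial (ν k) 1) = 0) ∨
      (∃ b', b = b' + 1 ∧ ∀ k p,
        normalForm ν g b (p * monomial (ν k) 1) = -normalForm ν g b' (p * g k)) →
      ∀ j p, normalForm ν g (b + 1) (p * monomial (ν j) 1) = -normalForm ν g b (p * g j) := by
    intro b hb j p
    induction p using MvPolynomial.induction_on' with
    | add p q hp hq => rw [add_mul, add_mul, map_add, map_add, hp, hq, neg_add]
    | monomial u c =>
      rw [monomial_eq_smul_monomial_one, smul_mul_assoc, smul_mul_assoc, map_smul,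
        map_smul, ← smul_neg, monomial_mul, one_mul]
      congr 1
      have hle : ν j ≤ u + ν j := le_add_of_nonneg_left zero_le
      obtain ⟨k, hk, hrec⟩ := exists_normalForm_succ ν g hle
      rw [hrec]
      by_cases hkj : k = j
      · subst hkj
        rw [add_tsub_cancel_right, mul_comm]
      -- If the chosen relation `k` differs from `j`, disjointness puts `ν k` inside `u`. Both
      -- relations can then be applied in either order, and the results agree because `g j * g k` is
      -- symmetric.
      have hku : ν k ≤ u := by
        intro i
        have h1 := hk i
        have h2 := DFunLike.congr_fun (disjoint_iff.1 (hν k j hkj)) i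
        rw [Finsupp.add_apply] at h1
        rw [Finsupp.inf_apply, bot_eq_zero, Finsupp.zero_apply] at h2
        rcases min_eq_iff.1 h2 with h | h
        · omega
        · omega
      obtain ⟨y, rfl⟩ := exists_add_of_le hku
      have h1 : ν k + y + ν j - ν k = y + ν j := by rw [add_assoc, add_tsub_cancel_left]
      have h2 : g k * monomial (y + ν j) (1 : ℂ) = (g k * monomial y 1) * monomial (ν j) 1 := by
        rw [mul_assoc, monomial_mul, one_mul]
      have h3 : monomial (ν k + y) (1 : ℂ) * g j = (g j * monomial y 1) * monomial (ν k) 1 := by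
        rw [mul_assoc, monomial_mul, one_mul, add_comm y, mul_comm]
      rw [h1, h2, h3]
      rcases hb with hb | ⟨b', -, hb⟩
      · rw [hb, hb]
      · rw [hb, hb, mul_right_comm, mul_right_comm (g j), mul_comm (g k) (g j)]
  induction b generalizing j p with
  | zero => exact hmon 0 (Or.inl (normalForm_zero_mul ν g)) j p
  | succ b ih => exact hmon (b + 1) (Or.inr ⟨b, rfl, ih⟩) j p

theorem weight_add (w : σ → ℝ) (a b : σ →₀ ℕ) : weight w (a + b) = weight w a + weight w b :=
  Finsupp.sum_add_index' (by simp) (by intros; push_cast; ring)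

theorem weight_single (w : σ → ℝ) (i : σ) (k : ℕ) :
    weight w (Finsupp.single i k) = k * w i :=
  Finsupp.sum_single_index (by simp)

theorem exists_mem_support_of_linearMap {τ : Type*}
    (L : MvPolynomial τ ℂ →ₗ[ℂ] MvPolynomial τ ℂ) (p : MvPolynomial τ ℂ) {d : τ →₀ ℕ}
    (hd : d ∈ (L p).support) : ∃ a ∈ p.support, d ∈ (L (monomial a 1)).support := by
  classical
  rw [← support_sum_monomial_coeff p, map_sum] at hd
  obtain ⟨a, ha, hda⟩ := Finset.mem_biUnion.1 (support_sum hd)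
  refine ⟨a, ha, ?_⟩
  rw [map_monomial_eq_smul] at hda
  exact support_smul hda

/-- With `s` the weight of `t`, each rewriting step replaces `x ^ ν k` by `t` times a monomial of `g
k` and so strictly lowers the weight. Only a monomial that is not rewritten keeps its weight. -/
theorem normalForm_weight {ν : ι → σ →₀ ℕ} {g : ι → MvPolynomial σ ℂ} {w : σ → ℝ} {s : ℝ}
    (hg : ∀ j, ∀ a ∈ (g j).support, s + weight w a < weight w (ν j)) (b : ℕ) (a d : σ →₀ ℕ)
    (hd : d ∈ (normalForm ν g b (monomial a 1)).support) :
    (b = 0 ∧ d = a) ∨ b * s + weight w d < weight w a := by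
  classical
  induction b generalizing a d with
  | zero =>
    by_cases h : ∃ j, ν j ≤ a
    · obtain ⟨j, hj⟩ := h
      simp [normalForm_zero_of_le ν g hj] at hd
    · rw [normalForm_zero_of_not_le ν g (by simpa using h)] at hd
      exact Or.inl ⟨rfl, by simpa using support_monomial_subset hd⟩
  | succ b ih =>
    right
    by_cases h : ∃ j, ν j ≤ a
    · obtain ⟨j, hj⟩ := h
      obtain ⟨k, hk, hrec⟩ := exists_normalForm_succ ν g hj
      rw [hrec, support_neg] at hd
      obtain ⟨e, he, hde⟩ := exists_mem_support_of_linearMap _ _ hd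
      obtain ⟨e', he', e'', he'', rfl⟩ := Finset.mem_add.1 (support_mul _ _ he)
      have h1 : e'' = a - ν k := by simpa using support_monomial_subset he''
      have h2 := hg k e' he'
      have h3 : weight w a = weight w (ν k) + weight w (a - ν k) := by
        rw [← weight_add, add_tsub_cancel_of_le hk]
      have h4 := weight_add w e' e''
      rw [← h1] at h3
      push_cast
      rcases ih _ _ hde with ⟨rfl, rfl⟩ | h5
      · push_cast; linarith
      · linarith
    · rw [normalForm_succ_of_not_le ν g b (by simpa using h)] at hd
      simp at hd

/-! ### The lead ideal of the family -/

theorem weight_option (w : Option σ → ℝ) (e : Option σ →₀ ℕ) :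
    weight w e = e none * w none + weight (fun r => w (some r)) e.some := by
  rw [weight, Finsupp.sum_option_index _ _ (by simp) (by intros; push_cast; ring)]
  rfl

theorem mapDomain_some_none (a : σ →₀ ℕ) : a.mapDomain some none = 0 :=
  Finsupp.mapDomain_of_notMem_range _ _ (by simp)

theorem some_mapDomain_some (a : σ →₀ ℕ) : (a.mapDomain some).some = a := by
  ext i
  exact Finsupp.mapDomain_apply (Option.some_injective σ) a i

theorem monomial_eq_X_none_pow_mul (e : Option σ →₀ ℕ) :
    monomial e (1 : ℂ) = X none ^ e none * rename some (monomial e.some 1) := by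
  rw [rename_monomial, X_pow_eq_monomial, monomial_mul, one_mul]
  congr 2
  refine Finsupp.ext fun i => ?_
  cases i with
  | none => simp [mapDomain_some_none]
  | some i => simp [Finsupp.mapDomain_apply (Option.some_injective σ)]

/-- The coefficient of `t ^ b * x ^ d` in the normal form of an element of `ℂ[t] ⊗ S`. -/
def normalCoeff (ν : ι → σ →₀ ℕ) (g : ι → MvPolynomial σ ℂ) (b : ℕ) (d : σ →₀ ℕ) :
    MvPolynomial (Option σ) ℂ →ₗ[ℂ] ℂ :=
  (basisMonomials (Option σ) ℂ).constr ℂ fun e =>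
    if e none ≤ b then coeff d (normalForm ν g (b - e none) (monomial e.some 1)) else 0

theorem normalCoeff_monomial (ν : ι → σ →₀ ℕ) (g : ι → MvPolynomial σ ℂ) (b : ℕ) (d : σ →₀ ℕ)
    (e : Option σ →₀ ℕ) : normalCoeff ν g b d (monomial e 1) =
      if e none ≤ b then coeff d (normalForm ν g (b - e none) (monomial e.some 1)) else 0 :=
  basisMonomials_constr_monomial _ e

theorem normalCoeff_X_none_pow_mul (ν : ι → σ →₀ ℕ) (g : ι → MvPolynomial σ ℂ) (b : ℕ)
    (d : σ →₀ ℕ) (i : ℕ) (p : MvPolynomial σ ℂ) :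
    normalCoeff ν g b d (X none ^ i * rename some p) =
      if i ≤ b then coeff d (normalForm ν g (b - i) p) else 0 := by
  induction p using MvPolynomial.induction_on' with
  | add p q hp hq =>
    rw [map_add, mul_add, map_add, hp, hq, map_add, coeff_add]
    split_ifs <;> simp
  | monomial u c =>
    have h1 : X none ^ i * rename some (monomial u c) =
        c • monomial (Finsupp.single none i + u.mapDomain some) (1 : ℂ) := by
      rw [rename_monomial, X_pow_eq_monomial, monomial_mul, one_mul, smul_monomial, smul_eq_mul,
        mul_one]
    have h2 : (Finsupp.single none i + u.mapDomain some : Option σ →₀ ℕ) none = i := by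
      simp [mapDomain_some_none]
    have h3 : (Finsupp.single none i + u.mapDomain some : Option σ →₀ ℕ).some = u := by
      ext k
      simp [Finsupp.mapDomain_apply (Option.some_injective σ)]
    rw [h1, map_smul, normalCoeff_monomial, h2, h3, map_monomial_eq_smul (normalForm ν g (b - i)) u c]
    split_ifs <;> simp

/-- For a monomial multiple of a generator, the contribution of `t * g j` cancels that of `x ^ ν j`
by `normalForm_succ_mul`. In the lowest power of `t` only a multiple of `x ^ ν j` contributes, and
its level-zero normal form vanishes. -/
theorem normalCoeff_eq_zero {ν : ι → σ →₀ ℕ} (hν : ∀ i j, i ≠ j → Disjoint (ν i) (ν j))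
    (g : ι → MvPolynomial σ ℂ) (b : ℕ) (d : σ →₀ ℕ) {f : MvPolynomial (Option σ) ℂ}
    (hf : f ∈ Ideal.span (Set.range fun j =>
      X none * rename some (g j) + rename some (monomial (ν j) 1))) :
    normalCoeff ν g b d f = 0 := by
  suffices h : ∀ h, normalCoeff ν g b d (h * f) = 0 by simpa using h 1
  induction hf using Submodule.span_induction with
  | zero => simp
  | add x y _ _ hx hy => intro h; rw [mul_add, map_add, hx, hy, add_zero]
  | smul a x _ hx => intro h; rw [smul_eq_mul, ← mul_assoc]; exact hx _
  | mem x hx =>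
    obtain ⟨j, rfl⟩ := hx
    intro h
    induction h using MvPolynomial.induction_on' with
    | add p q hp hq => rw [add_mul, map_add, hp, hq, add_zero]
    | monomial u c =>
      have h1 : monomial u c * (X none * rename some (g j) + rename some (monomial (ν j) 1)) =
          c • (X none ^ (u none + 1) * rename some (monomial u.some 1 * g j) +
            X none ^ (u none) * rename some (monomial u.some 1 * monomial (ν j) 1)) := by
        rw [monomial_eq_smul_monomial_one, monomial_eq_X_none_pow_mul, map_mul,
          map_mul, smul_mul_assoc]
        congr 1
        ring
      rw [h1, map_smul, map_add, normalCoeff_X_none_pow_mul, normalCoeff_X_none_pow_mul]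
      rcases lt_trichotomy (u none) b with hlt | heq | hgt
      · obtain ⟨k, rfl⟩ := Nat.exists_eq_add_of_lt hlt
        rw [if_pos (by omega), if_pos (by omega),
          show u none + k + 1 - (u none + 1) = k by omega,
          show u none + k + 1 - u none = k + 1 by omega, normalForm_succ_mul hν, coeff_neg,
          add_neg_cancel, smul_zero]
      · rw [if_neg (by omega), if_pos (by omega), heq, Nat.sub_self, normalForm_zero_mul]
        simp
      · rw [if_neg (by omega), if_neg (by omega), add_zero, smul_zero]

theorem weightLT_trichotomous (w : σ → ℝ) (o : MonomialOrdering σ) {a b : σ →₀ ℕ} (h : a ≠ b) :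
    weightLT w o a b ∨ weightLT w o b a := by
  rcases lt_trichotomy (weight w a) (weight w b) with h1 | h1 | h1
  · exact Or.inl (Or.inl h1)
  · by_contra! hno
    simp only [weightLT, h1, lt_self_iff_false, false_or, true_and] at hno
    have := o.strictTotal
    exact h (Std.Trichotomous.trichotomous (r := o.lt) a b hno.1 hno.2)
  · exact Or.inr (Or.inl h1)

theorem weightLT_trans (w : σ → ℝ) (o : MonomialOrdering σ) {a b c : σ →₀ ℕ}
    (h₁ : weightLT w o a b) (h₂ : weightLT w o b c) : weightLT w o a c := by
  have := o.strictTotal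
  rcases h₁ with h₁ | ⟨h₁, h₁'⟩ <;> rcases h₂ with h₂ | ⟨h₂, h₂'⟩
  · exact Or.inl (h₁.trans h₂)
  · exact Or.inl (h₂ ▸ h₁)
  · exact Or.inl (h₁ ▸ h₂)
  · exact Or.inr ⟨h₁.trans h₂, IsTrans.trans _ _ _ h₁' h₂'⟩

theorem weightLT.le {w : σ → ℝ} {o : MonomialOrdering σ} {a b : σ →₀ ℕ} (h : weightLT w o a b) :
    weight w a ≤ weight w b := by
  rcases h with h | h
  · exact h.le
  · exact h.1.le

theorem exists_weightLT_max (w : σ → ℝ) (o : MonomialOrdering σ) {s : Finset (σ →₀ ℕ)}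
    (hs : s.Nonempty) : ∃ a ∈ s, ∀ b ∈ s, b ≠ a → weightLT w o b a := by
  induction hs using Finset.Nonempty.cons_induction with
  | singleton a => exact ⟨a, by simp, by simp⟩
  | cons a s _ _ ih =>
    obtain ⟨m, hm, hmax⟩ := ih
    by_cases ham : a = m
    · refine ⟨m, by simp [hm], fun b hb hbm => ?_⟩
      rcases Finset.mem_cons.1 hb with rfl | hb
      · exact absurd ham hbm
      · exact hmax b hb hbm
    rcases weightLT_trichotomous w o ham with h | h
    · refine ⟨m, by simp [hm], fun b hb hbm => ?_⟩
      rcases Finset.mem_cons.1 hb with rfl | hb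
      · exact h
      · exact hmax b hb hbm
    · refine ⟨a, by simp, fun b hb hba => ?_⟩
      rcases Finset.mem_cons.1 hb with rfl | hb
      · exact absurd rfl hba
      · by_cases hbm : b = m
        · rwa [hbm]
        · exact weightLT_trans w o (hmax b hb hbm) h

theorem coeff_family (g : MvPolynomial σ ℂ) (ν : σ →₀ ℕ) (e : Option σ →₀ ℕ) :
    e ∈ (X none * rename some g + rename some (monomial ν (1 : ℂ))).support ↔
      e = ν.mapDomain some ∨
        ∃ a ∈ g.support, e = Finsupp.single none 1 + a.mapDomain some := by
  classical
  have hinj := Finsupp.mapDomain_injective (M := ℕ) (Option.some_injective σ)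
  rw [mem_support_iff, coeff_add, rename_monomial, coeff_monomial]
  by_cases he : e none = 0
  · have h1 : coeff e (X none * rename some g) = 0 := by
      rw [mul_comm, coeff_mul_X', if_neg (by simp [he])]
    rw [h1, zero_add]
    constructor
    · intro h
      left
      by_contra hne
      exact h (if_neg (Ne.symm hne))
    · rintro (h | ⟨a, -, rfl⟩)
      · simp [h]
      · simp [mapDomain_some_none] at he
  · have h2 : ν.mapDomain some ≠ e := by
      rintro rfl
      exact he (mapDomain_some_none ν)
    rw [if_neg h2, add_zero, ← mem_support_iff, mul_comm, support_mul_X]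
    rw [Finset.mem_map]
    have h3 : (rename some g).support = g.support.image (Finsupp.mapDomain some) :=
      support_rename_of_injective (Option.some_injective σ)
    rw [h3]
    constructor
    · rintro ⟨_, h, rfl⟩
      obtain ⟨a, ha, rfl⟩ := Finset.mem_image.1 h
      exact Or.inr ⟨a, ha, add_comm _ _⟩
    · rintro (h | ⟨a, ha, rfl⟩)
      · exact absurd h.symm h2
      · exact ⟨_, Finset.mem_image_of_mem _ ha, add_comm _ _⟩

/-- If all monomials of `t * g j` have smaller weight than `x ^ ν j`, then the lead ideal of the
family is generated by the monomials `x ^ ν j`. -/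
theorem leadIdeal_family {ν : ι → σ →₀ ℕ} (hν : ∀ i j, i ≠ j → Disjoint (ν i) (ν j))
    {g : ι → MvPolynomial σ ℂ} {w : Option σ → ℝ} (o : MonomialOrdering (Option σ))
    (hg : ∀ j, ∀ a ∈ (g j).support,
      w none + weight (fun r => w (some r)) a < weight (fun r => w (some r)) (ν j)) :
    leadIdeal (weightLT w o) (Ideal.span (Set.range fun j =>
      X none * rename some (g j) + rename some (monomial (ν j) 1))) =
    Ideal.span (Set.range fun j => monomial ((ν j).mapDomain some) (1 : ℂ)) := by
  classical
  apply le_antisymm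
  · rw [leadIdeal, Ideal.span_le]
    rintro _ ⟨f, hf, a, ha, hmax, rfl⟩
    by_cases hle : ∃ j, ν j ≤ a.some
    · obtain ⟨j, hj⟩ := hle
      have hja : (ν j).mapDomain some ≤ a := by
        intro i
        cases i with
        | none => rw [mapDomain_some_none]; exact Nat.zero_le _
        | some i =>
          rw [Finsupp.mapDomain_apply (Option.some_injective σ)]
          exact hj i
      obtain ⟨y, rfl⟩ := exists_add_of_le hja
      have h1 : monomial ((ν j).mapDomain some + y) (1 : ℂ) =
          monomial ((ν j).mapDomain some) 1 * monomial y 1 := by rw [monomial_mul, one_mul]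
      rw [h1]
      exact Ideal.mul_mem_right _ _ (Ideal.subset_span ⟨j, rfl⟩)
    exfalso
    push Not at hle
    -- Compare coefficients at the lead exponent `a`, assumed irreducible. It contributes its own
    -- coefficient of `f`; by `normalForm_weight` another monomial could contribute only if it were
    -- heavier than `a`.
    have h0 := normalCoeff_eq_zero hν g (a none) a.some hf
    rw [← support_sum_monomial_coeff f, map_sum,
      Finset.sum_eq_single_of_mem a ha, map_monomial_eq_smul, normalCoeff_monomial, if_pos le_rfl,
      Nat.sub_self, normalForm_zero_of_not_le ν g hle, coeff_monomial, if_pos rfl, smul_eq_mul,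
      mul_one] at h0
    · exact mem_support_iff.1 ha h0
    · intro e he hea
      rw [map_monomial_eq_smul, normalCoeff_monomial]
      split_ifs with hea'
      · suffices h : coeff a.some (normalForm ν g (a none - e none) (monomial e.some 1)) = 0 by
          rw [h, smul_zero]
        by_contra hne
        have hwle := (hmax e he hea).le
        rw [weight_option, weight_option w a] at hwle
        rcases normalForm_weight hg _ _ _ (mem_support_iff.2 hne) with ⟨h1, h2⟩ | h
        · apply hea
          refine Finsupp.ext fun i => ?_
          cases i with
          | none => omega
          | some i => exact (DFunLike.congr_fun h2 i).symm
        · rw [Nat.cast_sub hea'] at h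
          linarith
      · exact smul_zero _
  · rw [Ideal.span_le]
    rintro _ ⟨j, rfl⟩
    apply Ideal.subset_span
    refine ⟨_, Ideal.subset_span ⟨j, rfl⟩, _, (coeff_family _ _ _).2 (Or.inl rfl), ?_, rfl⟩
    intro b hb hne
    rcases (coeff_family _ _ _).1 hb with rfl | ⟨a, ha, rfl⟩
    · exact absurd rfl hne
    · left
      have h1 : weight w (Finsupp.single none 1) = w none := by simp [weight_single]
      rw [weight_add, h1, weight_option w (a.mapDomain some), weight_option w ((ν j).mapDomain some),
        mapDomain_some_none, mapDomain_some_none, some_mapDomain_some, some_mapDomain_some]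
      simpa using hg j a ha

/-- If the lead ideal of the family is generated by the monomials `x ^ ν j`, then the monomials of
`t * g j` outside of this ideal have at most the weight of `x ^ ν j`. -/
theorem weight_le_of_leadIdeal_family {ν : ι → σ →₀ ℕ} {g : ι → MvPolynomial σ ℂ}
    {w : Option σ → ℝ} {o : MonomialOrdering (Option σ)}
    (hlead : leadIdeal (weightLT w o) (Ideal.span (Set.range fun j =>
      X none * rename some (g j) + rename some (monomial (ν j) 1))) =
      Ideal.span (Set.range fun j => monomial ((ν j).mapDomain some) (1 : ℂ)))
    (hfree : ∀ j, ∀ a ∈ (g j).support, ∀ k, ¬ ν k ≤ a) (j : ι) (a : σ →₀ ℕ)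
    (ha : a ∈ (g j).support) :
    w none + weight (fun r => w (some r)) a ≤ weight (fun r => w (some r)) (ν j) := by
  obtain ⟨e, he, hmax⟩ := exists_weightLT_max w o
    (s := (X none * rename some (g j) + rename some (monomial (ν j) (1 : ℂ))).support)
    ⟨_, (coeff_family _ _ _).2 (Or.inl rfl)⟩
  have hmem : monomial e (1 : ℂ) ∈ Ideal.span
      (Set.range fun j => monomial ((ν j).mapDomain some) (1 : ℂ)) := by
    rw [← hlead]
    exact Ideal.subset_span ⟨_, Ideal.subset_span ⟨j, rfl⟩, e, he, hmax, rfl⟩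
  have hdvd : ∃ k, (ν k).mapDomain some ≤ e := by
    have hr : (Set.range fun j => monomial ((ν j).mapDomain some) (1 : ℂ)) =
        (fun s => monomial s (1 : ℂ)) '' Set.range fun j => (ν j).mapDomain some := by
      rw [← Set.range_comp]; rfl
    rw [hr, mem_ideal_span_monomial_image] at hmem
    obtain ⟨_, ⟨k, rfl⟩, hk⟩ := hmem e (by classical simp [support_monomial])
    exact ⟨k, hk⟩
  obtain ⟨k, hk⟩ := hdvd
  have he' : e = (ν j).mapDomain some := by
    rcases (coeff_family _ _ _).1 he with h | ⟨a', ha', rfl⟩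
    · exact h
    · exfalso
      refine hfree j a' ha' k fun i => ?_
      have := hk (some i)
      simpa [Finsupp.mapDomain_apply (Option.some_injective σ)] using this
  have h2 := hmax _ ((coeff_family _ _ _).2 (Or.inr ⟨a, ha, rfl⟩)) (by
    rw [he']
    intro h
    have := DFunLike.congr_fun h none
    simp [mapDomain_some_none] at this)
  have h3 := h2.le
  have h1 : weight w (Finsupp.single none 1) = w none := by simp [weight_single]
  rw [he', weight_add, h1, weight_option w (a.mapDomain some),
    weight_option w ((ν j).mapDomain some), mapDomain_some_none, mapDomain_some_none,
    some_mapDomain_some, some_mapDomain_some] at h3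
  simpa using h3

end NormalForm

/-! ### Fixed points over the field of Hahn series -/

section Hahn

open HahnSeries

/-- The `s`-adic limit of a sequence of Hahn series. -/
theorem exists_hahn_limit {ε : ℝ} (hε : 0 < ε) (x : ℕ → HahnSeries ℝ ℂ)
    (hx : ∀ k : ℕ, ((k * ε : ℝ) : WithTop ℝ) ≤ (x (k + 1) - x k).orderTop) :
    ∃ y : HahnSeries ℝ ℂ, ∀ k : ℕ, ((k * ε : ℝ) : WithTop ℝ) ≤ (y - x k).orderTop := by
  have hstep : ∀ k : ℕ, ∀ e : ℝ, e < k * ε → (x (k + 1)).coeff e = (x k).coeff e := by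
    intro k e he
    have := (le_orderTop_iff_forall.1 (hx k)) e (by exact_mod_cast he)
    rwa [HahnSeries.coeff_sub, sub_eq_zero] at this
  have hmono : ∀ k d : ℕ, ∀ e : ℝ, e < k * ε → (x (k + d)).coeff e = (x k).coeff e := by
    intro k d e he
    induction d with
    | zero => rfl
    | succ d ih =>
      rw [← add_assoc, hstep _ _ (he.trans_le ?_), ih]
      gcongr
      simp
  have hstable : ∀ k l : ℕ, ∀ e : ℝ, e < k * ε → e < l * ε → (x k).coeff e = (x l).coeff e := by
    intro k l e hk hl
    rcases le_total k l with h | h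
    · obtain ⟨d, rfl⟩ := Nat.exists_eq_add_of_le h
      exact (hmono k d e hk).symm
    · obtain ⟨d, rfl⟩ := Nat.exists_eq_add_of_le h
      exact hmono l d e hl
  have hN : ∀ e : ℝ, ∃ N : ℕ, e < N * ε := fun e => by
    obtain ⟨N, hN⟩ := exists_nat_gt (e / ε)
    exact ⟨N, (div_lt_iff₀ hε).1 hN⟩
  choose N hN using hN
  let y : HahnSeries ℝ ℂ :=
    { coeff := fun e => (x (N e)).coeff e
      -- A descending sequence in the support stays below its first term, where the limit agrees
      -- with a single member of the sequence.
      isPWO_support' := by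
        rw [Set.isPWO_iff_isWF, Set.isWF_iff_no_descending_seq]
        intro f hf hmem
        refine Set.isWF_iff_no_descending_seq.1 (x (N (f 0))).isWF_support f hf fun n => ?_
        have h1 : f n < N (f 0) * ε := (hf.antitone (Nat.zero_le n)).trans_lt (hN (f 0))
        have h2 := hmem n
        rw [Function.mem_support, hstable _ _ _ (hN (f n)) h1] at h2
        exact h2 }
  refine ⟨y, fun k => le_orderTop_iff_forall.2 fun e he => ?_⟩
  rw [HahnSeries.coeff_sub, sub_eq_zero]
  exact hstable _ _ _ (hN e) (by exact_mod_cast he)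

theorem eq_zero_of_forall_le_orderTop {ε : ℝ} (hε : 0 < ε) {y : HahnSeries ℝ ℂ}
    (hy : ∀ k : ℕ, ((k * ε : ℝ) : WithTop ℝ) ≤ y.orderTop) : y = 0 := by
  ext e
  obtain ⟨N, hN⟩ := exists_nat_gt (e / ε)
  exact (le_orderTop_iff_forall.1 (hy N)) e (by exact_mod_cast (div_lt_iff₀ hε).1 hN)

theorem le_orderTop_sub {a : WithTop ℝ} {x y : HahnSeries ℝ ℂ} (hx : a ≤ x.orderTop)
    (hy : a ≤ y.orderTop) : a ≤ (x - y).orderTop :=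
  (le_min hx hy).trans min_orderTop_le_orderTop_sub

theorem le_orderTop_add {a : WithTop ℝ} {x y : HahnSeries ℝ ℂ} (hx : a ≤ x.orderTop)
    (hy : a ≤ y.orderTop) : a ≤ (x + y).orderTop :=
  (le_min hx hy).trans min_orderTop_le_orderTop_add

theorem le_orderTop_sum {α : Type*} {a : WithTop ℝ} {s : Finset α} {f : α → HahnSeries ℝ ℂ}
    (h : ∀ i ∈ s, a ≤ (f i).orderTop) : a ≤ (∑ i ∈ s, f i).orderTop := by
  classical
  induction s using Finset.induction_on with
  | empty => simp
  | insert i s hi ih =>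
    rw [Finset.sum_insert hi]
    exact le_orderTop_add (h i (Finset.mem_insert_self i s))
      (ih fun k hk => h k (Finset.mem_insert_of_mem hk))

theorem le_orderTop_mul_of_nonneg {a : WithTop ℝ} {x y : HahnSeries ℝ ℂ} (hx : a ≤ x.orderTop)
    (hy : 0 ≤ y.orderTop) : a ≤ (x * y).orderTop := by
  rw [orderTop_mul]
  exact le_add_of_le_of_nonneg hx hy

theorem orderTop_prod_nonneg {α : Type*} {s : Finset α} {f : α → HahnSeries ℝ ℂ}
    (h : ∀ i ∈ s, 0 ≤ (f i).orderTop) : 0 ≤ (∏ i ∈ s, f i).orderTop := by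
  classical
  induction s using Finset.induction_on with
  | empty => simp
  | insert i s hi ih =>
    rw [Finset.prod_insert hi]
    exact le_orderTop_mul_of_nonneg (h i (Finset.mem_insert_self i s))
      (ih fun k hk => h k (Finset.mem_insert_of_mem hk))

theorem orderTop_pow_nonneg {x : HahnSeries ℝ ℂ} (h : 0 ≤ x.orderTop) (k : ℕ) :
    0 ≤ (x ^ k).orderTop := by
  rw [← Finset.card_range k, ← Finset.prod_const]
  exact orderTop_prod_nonneg fun _ _ => h

theorem le_orderTop_prod_sub_prod {α : Type*} {a : WithTop ℝ} {s : Finset α}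
    {f g : α → HahnSeries ℝ ℂ} (hf : ∀ i ∈ s, 0 ≤ (f i).orderTop)
    (hg : ∀ i ∈ s, 0 ≤ (g i).orderTop) (h : ∀ i ∈ s, a ≤ (f i - g i).orderTop) :
    a ≤ (∏ i ∈ s, f i - ∏ i ∈ s, g i).orderTop := by
  classical
  induction s using Finset.induction_on with
  | empty => simp
  | insert i s hi ih =>
    have h1 : f i * ∏ k ∈ s, f k - g i * ∏ k ∈ s, g k =
        (f i - g i) * ∏ k ∈ s, f k + (∏ k ∈ s, f k - ∏ k ∈ s, g k) * g i := by ring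
    rw [Finset.prod_insert hi, Finset.prod_insert hi, h1]
    simp only [Finset.forall_mem_insert] at hf hg h
    exact le_orderTop_add (le_orderTop_mul_of_nonneg h.1 (orderTop_prod_nonneg hf.2))
      (le_orderTop_mul_of_nonneg (ih hf.2 hg.2 h.2) hg.1)

theorem le_orderTop_pow_sub_pow {a : WithTop ℝ} {x y : HahnSeries ℝ ℂ} (hx : 0 ≤ x.orderTop)
    (hy : 0 ≤ y.orderTop) (h : a ≤ (x - y).orderTop) (k : ℕ) :
    a ≤ (x ^ k - y ^ k).orderTop := by
  rw [← Finset.card_range k, ← Finset.prod_const, ← Finset.prod_const]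
  exact le_orderTop_prod_sub_prod (fun _ _ => hx) (fun _ _ => hy) fun _ _ => h

/-- A contraction of the valuation ring has a fixed point. -/
theorem exists_hahn_fixedPoint {ι : Type*} {ε : ℝ} (hε : 0 < ε)
    (G : (ι → HahnSeries ℝ ℂ) → ι → HahnSeries ℝ ℂ)
    (h0 : ∀ x, (∀ i, 0 ≤ (x i).orderTop) → ∀ i, 0 ≤ (G x i).orderTop)
    (hG : ∀ x y, (∀ i, 0 ≤ (x i).orderTop) → (∀ i, 0 ≤ (y i).orderTop) → ∀ a : ℝ,
      (∀ i, (a : WithTop ℝ) ≤ (x i - y i).orderTop) →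
      ∀ i, ((a + ε : ℝ) : WithTop ℝ) ≤ (G x i - G y i).orderTop) :
    ∃ x, (∀ i, 0 ≤ (x i).orderTop) ∧ G x = x := by
  let x : ℕ → ι → HahnSeries ℝ ℂ := fun k => G^[k] 0
  have hsucc : ∀ k, x (k + 1) = G (x k) := fun k => Function.iterate_succ_apply' G k 0
  have hnn : ∀ k i, 0 ≤ (x k i).orderTop := by
    intro k
    induction k with
    | zero => intro i; simp [x]
    | succ k ih => rw [hsucc]; exact h0 _ ih
  have hsteps : ∀ k : ℕ, ∀ i, ((k * ε : ℝ) : WithTop ℝ) ≤ (x (k + 1) i - x k i).orderTop := by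
    intro k
    induction k with
    | zero =>
      intro i
      simpa using le_orderTop_sub (hnn 1 i) (hnn 0 i)
    | succ k ih =>
      intro i
      have h1 := hG _ _ (hnn (k + 1)) (hnn k) _ ih i
      rw [← hsucc, ← hsucc] at h1
      have h2 : ((k + 1 : ℕ) : ℝ) * ε = k * ε + ε := by push_cast; ring
      rwa [h2]
  choose y hy using fun i => exists_hahn_limit hε (fun k => x k i) fun k => hsteps k i
  have hynn : ∀ i, 0 ≤ (y i).orderTop := fun i => by
    have h1 := hy i 0
    have h2 : y i = (y i - x 0 i) + x 0 i := by ring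
    rw [h2]
    exact le_orderTop_add (by simpa using h1) (hnn 0 i)
  refine ⟨y, hynn, ?_⟩
  funext i
  rw [← sub_eq_zero]
  apply eq_zero_of_forall_le_orderTop hε
  intro k
  have h1 := hG _ _ hynn (hnn k) _ (fun i => hy i k) i
  have h2 := hy i (k + 1)
  rw [hsucc] at h2
  have h3 : G y i - y i = (G y i - G (x k) i) - (y i - G (x k) i) := by ring
  rw [h3]
  refine le_orderTop_sub (le_trans ?_ h1) (le_trans ?_ h2)
  · exact_mod_cast (by linarith : (k : ℝ) * ε ≤ k * ε + ε)
  · exact_mod_cast (by push_cast; linarith : (k : ℝ) * ε ≤ ((k + 1 : ℕ) : ℝ) * ε)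

/-- A polynomial system `x j = ∑ m, b j m * x ^ (k j m)` over the valuation ring, the coefficients
of whose nonconstant terms have positive valuation, has a solution. -/
theorem exists_hahn_solution {ι : Type*} [Fintype ι] {α : ι → Type*} [∀ j, Fintype (α j)]
    (b : ∀ j, α j → HahnSeries ℝ ℂ) (k : ∀ j, α j → ι → ℕ) (hb : ∀ j m, 0 ≤ (b j m).orderTop)
    (hk : ∀ j m, 0 < (b j m).orderTop ∨ k j m = 0) :
    ∃ x : ι → HahnSeries ℝ ℂ, (∀ i, 0 ≤ (x i).orderTop) ∧
      ∀ j, x j = ∑ m, b j m * ∏ i, x i ^ k j m i := by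
  classical
  -- The contraction constant is the least of finitely many positive valuations, with `1` standing
  -- in where the valuation is infinite or irrelevant.
  obtain ⟨ε, hε, hεb⟩ : ∃ ε : ℝ, 0 < ε ∧ ∀ j m, k j m ≠ 0 → (ε : WithTop ℝ) ≤ (b j m).orderTop := by
    have h : ∀ p : Σ j, α j, ∃ ε : ℝ, 0 < ε ∧
        (k p.1 p.2 ≠ 0 → (ε : WithTop ℝ) ≤ (b p.1 p.2).orderTop) := by
      rintro ⟨j, m⟩
      rcases hk j m with h | h
      · cases ho : (b j m).orderTop with
        | top => exact ⟨1, one_pos, fun _ => by simp⟩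
        | coe a =>
          rw [ho] at h
          exact ⟨a, by exact_mod_cast h, fun _ => le_rfl⟩
      · exact ⟨1, one_pos, fun h' => absurd h h'⟩
    choose e he heb using h
    rcases isEmpty_or_nonempty (Σ j, α j) with hE | hE
    · exact ⟨1, one_pos, fun j m => hE.elim ⟨j, m⟩⟩
    · refine ⟨Finset.univ.inf' Finset.univ_nonempty e,
        (Finset.lt_inf'_iff _).2 fun p _ => he p, fun j m hjm => le_trans ?_ (heb ⟨j, m⟩ hjm)⟩
      exact_mod_cast Finset.inf'_le _ (Finset.mem_univ (⟨j, m⟩ : Σ j, α j))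
  obtain ⟨x, hx, hfix⟩ := exists_hahn_fixedPoint hε
    (fun x j => ∑ m, b j m * ∏ i, x i ^ k j m i)
    (fun x hx j => le_orderTop_sum fun m _ => le_orderTop_mul_of_nonneg (hb j m)
      (orderTop_prod_nonneg fun i _ => orderTop_pow_nonneg (hx i) _))
    (fun x y hx hy a ha j => by
      rw [← Finset.sum_sub_distrib]
      refine le_orderTop_sum fun m _ => ?_
      rw [← mul_sub]
      by_cases hkm : k j m = 0
      · simp [hkm]
      · rw [orderTop_mul, WithTop.coe_add, add_comm]
        refine add_le_add (hεb j m hkm) (le_orderTop_prod_sub_prod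
          (fun i _ => orderTop_pow_nonneg (hx i) _) (fun i _ => orderTop_pow_nonneg (hy i) _)
          fun i _ => le_orderTop_pow_sub_pow (hx i) (hy i) (ha i) _))
  exact ⟨x, hx, fun j => (congrFun hfix j).symm⟩

end Hahn

/-! ### The exponents of sections -/

section Exponents

variable {n c : ℕ} {Δ : Set (Fin n → ℝ)} [Fintype (Ray Δ)]

/-- The exponent of the Cox monomial of the section `m` of `𝒪(E_j)`. -/
def sectionExp (part : Ray Δ → Fin c) (j : Fin c) (m : Fin n → ℤ) : Ray Δ →₀ ℕ :=
  Finsupp.equivFunOnFinite.symm fun r => (m ⬝ᵥ r.gen + blockDivisor part j r).toNat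

theorem sectionExp_cast {part : Ray Δ → Fin c} {j : Fin c} {m : Fin n → ℤ}
    (hm : m ∈ sections (blockDivisor part j)) (r : Ray Δ) :
    (sectionExp part j m r : ℤ) = m ⬝ᵥ r.gen + blockDivisor part j r :=
  Int.toNat_of_nonneg (hm r)

theorem sectionExp_zero_cast (part : Ray Δ → Fin c) (j : Fin c) (r : Ray Δ) :
    (sectionExp part j 0 r : ℤ) = blockDivisor part j r := by
  rw [sectionExp_cast (zero_mem_sections_blockDivisor part j), zero_dotProduct, zero_add]

theorem sectionExp_zero_apply (part : Ray Δ → Fin c) (j : Fin c) (r : Ray Δ) :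
    sectionExp part j 0 r = if part r = j then 1 else 0 := by
  have := sectionExp_zero_cast part j r
  rw [blockDivisor] at this
  split_ifs at this ⊢ <;> omega

theorem sectionMonomial_eq (part : Ray Δ → Fin c) (j : Fin c) (m : Fin n → ℤ) :
    sectionMonomial (blockDivisor part j) m = monomial (sectionExp part j m) 1 := by
  rw [sectionMonomial, finprod_eq_prod_of_fintype, monomial_eq, C_1, one_mul,
    Finsupp.prod_fintype _ _ (by simp)]
  rfl

theorem prodVars_block (part : Ray Δ → Fin c) (j : Fin c) :
    prodVars (block part j) = monomial (sectionExp part j 0) 1 := by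
  classical
  rw [prodVars, finprod_mem_def, finprod_eq_prod_of_fintype, monomial_eq, C_1, one_mul,
    Finsupp.prod_fintype _ _ (by simp)]
  refine Finset.prod_congr rfl fun r _ => ?_
  rw [sectionExp_zero_apply, Set.mulIndicator_apply]
  by_cases h : part r = j
  · rw [if_pos h, if_pos (show r ∈ block part j from h), pow_one]
  · rw [if_neg h, if_neg (show r ∉ block part j from h), pow_zero]

theorem disjoint_sectionExp_zero (part : Ray Δ → Fin c) (i j : Fin c) (h : i ≠ j) :
    Disjoint (sectionExp part i 0) (sectionExp part j 0) := by
  rw [disjoint_iff]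
  refine Finsupp.ext fun r => ?_
  rw [Finsupp.inf_apply, sectionExp_zero_apply, sectionExp_zero_apply]
  by_cases h1 : part r = i
  · rw [if_neg (fun h2 => h (h1.symm.trans h2))]; exact min_eq_right zero_le
  · rw [if_neg h1]; exact min_eq_left zero_le

theorem specialIdeal_eq (part : Ray Δ → Fin c) :
    specialIdeal part = Ideal.span (Set.range fun j => monomial (sectionExp part j 0) (1 : ℂ)) := by
  simp only [specialIdeal, monomialIdeal, prodVars_block]

theorem map_specialIdeal_eq (part : Ray Δ → Fin c) :
    (specialIdeal part).map (incl Δ).toRingHom =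
      Ideal.span (Set.range fun j => monomial ((sectionExp part j 0).mapDomain some) (1 : ℂ)) := by
  rw [specialIdeal_eq, Ideal.map_span, ← Set.range_comp]
  congr 2
  funext j
  exact rename_monomial _ _ _

theorem familyIdeal_eq (part : Ray Δ → Fin c) (a : CoeffIndex part → ℂ) :
    familyIdeal part a = Ideal.span (Set.range fun j =>
      X none * rename some (genSection part a j) +
        rename some (monomial (sectionExp part j 0) (1 : ℂ))) := by
  simp only [familyIdeal, prodVars_block]
  rfl

theorem sectionMonomial_mem_specialIdeal (part : Ray Δ → Fin c) (j : Fin c) (m : Fin n → ℤ) :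
    sectionMonomial (blockDivisor part j) m ∈ specialIdeal part ↔
      ∃ k, sectionExp part k 0 ≤ sectionExp part j m := by
  classical
  have hr : (Set.range fun j => monomial (sectionExp part j 0) (1 : ℂ)) =
      (fun s => monomial s (1 : ℂ)) '' Set.range fun j => sectionExp part j 0 := by
    rw [← Set.range_comp]; rfl
  rw [specialIdeal_eq, sectionMonomial_eq, hr, mem_ideal_span_monomial_image]
  simp [support_monomial]

theorem FreeSection.not_le {part : Ray Δ → Fin c} {j : Fin c} (m : FreeSection part j) (k : Fin c) :
    ¬ sectionExp part k 0 ≤ sectionExp part j m.1 := fun h =>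
  m.2.2 ((sectionMonomial_mem_specialIdeal part j m.1).2 ⟨k, h⟩)

theorem exists_blockDivisor_le {part : Ray Δ → Fin c} {j : Fin c} {m : Fin n → ℤ}
    (hm : m ∈ sections (blockDivisor part j))
    (h : sectionMonomial (blockDivisor part j) m ∈ specialIdeal part) :
    ∃ k, ∀ r, blockDivisor part k r ≤ m ⬝ᵥ r.gen + blockDivisor part j r := by
  obtain ⟨k, hk⟩ := (sectionMonomial_mem_specialIdeal part j m).1 h
  refine ⟨k, fun r => ?_⟩
  rw [← sectionExp_zero_cast, ← sectionExp_cast hm]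
  exact_mod_cast hk r

/-- The rays span, because every vector lies in a cone of the fan. Hence distinct sections have
distinct Cox monomials and no terms of `g_j` cancel. -/
theorem eq_of_dotProduct_gen_eq (hΔ : IsReflexive Δ) {m m' : Fin n → ℤ}
    (h : ∀ r : Ray Δ, m ⬝ᵥ r.gen = m' ⬝ᵥ r.gen) : m = m' := by
  have hall : ∀ w : Fin n → ℝ, toReal m ⬝ᵥ w = toReal m' ⬝ᵥ w := fun w => by
    by_cases hw : w = 0
    · simp [hw]
    obtain ⟨u, -, l, -, rfl, -⟩ := hΔ.exists_cone hw
    simp only [dotProduct_conic, h]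
  apply toReal_injective
  exact dotProduct_eq _ _ hall

theorem sectionExp_injOn (hΔ : IsReflexive Δ) (part : Ray Δ → Fin c) (j : Fin c) :
    Set.InjOn (sectionExp part j) (sections (blockDivisor part j)) := by
  intro m hm m' hm' h
  refine eq_of_dotProduct_gen_eq hΔ fun r => ?_
  have h1 := sectionExp_cast hm r
  rw [h, sectionExp_cast hm' r] at h1
  linarith

theorem genSection_eq (part : Ray Δ → Fin c) (j : Fin c) [Fintype (FreeSection part j)]
    (a : CoeffIndex part → ℂ) :
    genSection part a j = ∑ m : FreeSection part j, monomial (sectionExp part j m.1) (a ⟨j, m⟩) := by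
  rw [genSection, finsum_eq_sum_of_fintype]
  refine Finset.sum_congr rfl fun m _ => ?_
  rw [sectionMonomial_eq, smul_monomial, smul_eq_mul, mul_one]

theorem mem_support_genSection (hΔ : IsReflexive Δ) (part : Ray Δ → Fin c) (j : Fin c)
    [Finite (FreeSection part j)] {a : CoeffIndex part → ℂ} (ha : ∀ i, a i ≠ 0)
    (e : Ray Δ →₀ ℕ) :
    e ∈ (genSection part a j).support ↔ ∃ m : FreeSection part j, e = sectionExp part j m.1 := by
  classical
  have := Fintype.ofFinite (FreeSection part j)
  rw [genSection_eq]
  constructor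
  · intro h
    obtain ⟨m, -, hm⟩ := Finset.mem_biUnion.1 (support_sum h)
    exact ⟨m, by simpa using support_monomial_subset hm⟩
  · rintro ⟨m, rfl⟩
    rw [mem_support_iff, coeff_sum, Finset.sum_eq_single m]
    · rw [coeff_monomial, if_pos rfl]
      exact ha _
    · intro m' _ hne
      rw [coeff_monomial, if_neg]
      intro h
      exact hne (Subtype.ext (sectionExp_injOn hΔ part j m'.2.1 m.2.1 h))
    · simp

/-- Homogeneity: two monomials of degree `[E_j]` differ by a character, so the difference of their
weights depends only on the class of the weight vector. This turns weight and valuation comparisons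
into inequalities on `N_ℝ`. -/
theorem sum_sectionExp_mul {part : Ray Δ → Fin c} {j : Fin c} {m : Fin n → ℤ}
    (hm : m ∈ sections (blockDivisor part j)) (u : Ray Δ → ℝ) :
    ∑ r, (sectionExp part j m r : ℝ) * u r =
      toReal m ⬝ᵥ weightClass u + ∑ r, (sectionExp part j 0 r : ℝ) * u r := by
  rw [weightClass, finsum_eq_sum_of_fintype, dotProduct_conic, ← Finset.sum_add_distrib]
  refine Finset.sum_congr rfl fun r _ => ?_
  have h1 : (sectionExp part j m r : ℝ) = ((m ⬝ᵥ r.gen : ℤ) : ℝ) + (blockDivisor part j r : ℝ) := by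
    exact_mod_cast sectionExp_cast hm r
  have h2 : (sectionExp part j 0 r : ℝ) = (blockDivisor part j r : ℝ) := by
    exact_mod_cast sectionExp_zero_cast part j r
  rw [h1, h2]
  ring

theorem weight_sectionExp {part : Ray Δ → Fin c} {j : Fin c} {m : Fin n → ℤ}
    (hm : m ∈ sections (blockDivisor part j)) (u : Ray Δ → ℝ) :
    weight u (sectionExp part j m) =
      toReal m ⬝ᵥ weightClass u + weight u (sectionExp part j 0) := by
  rw [weight, weight, Finsupp.sum_fintype _ _ (by simp), Finsupp.sum_fintype _ _ (by simp)]
  exact sum_sectionExp_mul hm u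

end Exponents

theorem finite_freeSection {n c : ℕ} {Δ : Set (Fin n → ℝ)} (hΔ : IsReflexive Δ) {part : Ray Δ → Fin c}
    (hpart : IsNefPartition part) (j : Fin c) : Finite (FreeSection part j) :=
  ((finite_sections hΔ hpart j).subset (s := sections (blockDivisor part j))
    (t := {m | m ∈ sections (blockDivisor part j) ∧
      sectionMonomial (blockDivisor part j) m ∉ specialIdeal part}) fun _ h => h.1).to_subtype

/-! ### The special fiber Gröbner cone -/

/-- The linear form `w ↦ ⟨m, w⟩`. -/
def dotForm {n : ℕ} (m : Fin n → ℝ) : StrongDual ℝ (Fin n → ℝ) :=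
  ∑ i, m i • ContinuousLinearMap.proj (R := ℝ) (φ := fun _ : Fin n => ℝ) i

theorem dotForm_apply {n : ℕ} (m w : Fin n → ℝ) : dotForm m w = m ⬝ᵥ w := by
  simp [dotForm, dotProduct]

/-- The linear form `(t, w) ↦ t + ⟨m, w⟩`. -/
def coneForm {n : ℕ} (m : Fin n → ℝ) : StrongDual ℝ (ℝ × (Fin n → ℝ)) :=
  ContinuousLinearMap.fst ℝ ℝ (Fin n → ℝ) +
    (dotForm m).comp (ContinuousLinearMap.snd ℝ ℝ (Fin n → ℝ))

theorem coneForm_apply {n : ℕ} (m : Fin n → ℝ) (p : ℝ × (Fin n → ℝ)) :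
    coneForm m p = p.1 + m ⬝ᵥ p.2 := by
  simp [coneForm, dotForm_apply]

/-- The cone `{(t, w) | t + ⟨m, w⟩ ≥ 0}`, `m` running over the sections whose Cox monomial is not
in `I₀`. -/
def freeCone {n c : ℕ} {Δ : Set (Fin n → ℝ)} (part : Ray Δ → Fin c) : Set (ℝ × (Fin n → ℝ)) :=
  polyhedron (fun i : CoeffIndex part => coneForm (toReal i.2.1)) fun _ => 0

theorem mem_freeCone {n c : ℕ} {Δ : Set (Fin n → ℝ)} {part : Ray Δ → Fin c}
    {p : ℝ × (Fin n → ℝ)} : p ∈ freeCone part ↔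
      ∀ j, ∀ m : FreeSection part j, 0 ≤ p.1 + toReal m.1 ⬝ᵥ p.2 := by
  refine ⟨fun h j m => ?_, fun h i => ?_⟩
  · rw [← coneForm_apply]
    exact h ⟨j, m⟩
  · rw [coneForm_apply]
    exact h i.1 i.2

theorem isClosed_polyhedron {E : Type*} [AddCommGroup E] [Module ℝ E] [TopologicalSpace E]
    {ι : Type*} (ℓ : ι → StrongDual ℝ E) (b : ι → ℝ) : IsClosed (polyhedron ℓ b) := by
  have h : polyhedron ℓ b = ⋂ i, {x | b i ≤ ℓ i x} := by
    ext x; simp [polyhedron]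
  rw [h]
  exact isClosed_iInter fun i => isClosed_le continuous_const (ℓ i).continuous

theorem weightClass_neg {n : ℕ} {Q : Set (Fin n → ℝ)} [Fintype (Ray Q)] (u : Ray Q → ℝ) :
    weightClass (fun r => -u r) = -weightClass u := by
  simp [weightClass, finsum_eq_sum_of_fintype, neg_smul, Finset.sum_neg_distrib]

/-- The weights with lead ideal `I₀` satisfy the inequalities `t + ⟨m, w⟩ ≥ 0`, and all points with
strict inequalities are realized by such weights; the closure absorbs the difference. -/
theorem specialFiberCone_eq {n c : ℕ} {Δ : Set (Fin n → ℝ)} (hΔ : IsReflexive Δ)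
    {part : Ray Δ → Fin c} (hpart : IsNefPartition part) {a : CoeffIndex part → ℂ}
    (ha : ∀ i, a i ≠ 0) (o : MonomialOrdering (Option (Ray Δ))) :
    specialFiberCone o (familyIdeal part a) (specialIdeal part) = freeCone part := by
  have := hΔ.finite_ray
  have := Fintype.ofFinite (Ray Δ)
  have := fun j => finite_freeSection hΔ hpart j
  rw [specialFiberCone, map_specialIdeal_eq, familyIdeal_eq]
  apply Set.Subset.antisymm
  · refine closure_minimal ?_ (isClosed_polyhedron _ _)
    rintro p ⟨w, hw, rfl⟩
    refine mem_freeCone.2 ?_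
    intro j m
    have h1 := weight_le_of_leadIdeal_family hw (fun j e he k => by
      obtain ⟨m, rfl⟩ := (mem_support_genSection hΔ part j ha e).1 he
      exact m.not_le k) j _ ((mem_support_genSection hΔ part j ha _).2 ⟨m, rfl⟩)
    rw [weight_sectionExp m.2.1] at h1
    simp only [Prod.neg_mk, dotProduct_neg]
    linarith
  · intro p hp
    rw [mem_freeCone] at hp
    -- Raising the height coordinate by `s > 0` makes all inequalities strict at once.
    have hlim : Filter.Tendsto (fun s : ℝ => p + s • ((1 : ℝ), (0 : Fin n → ℝ)))
        (nhdsWithin 0 (Set.Ioi 0)) (nhds p) := by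
      have h1 : Filter.Tendsto (fun s : ℝ => p + s • ((1 : ℝ), (0 : Fin n → ℝ))) (nhds 0)
          (nhds (p + (0 : ℝ) • ((1 : ℝ), (0 : Fin n → ℝ)))) := Continuous.tendsto (by fun_prop) 0
      rw [zero_smul, add_zero] at h1
      exact h1.mono_left nhdsWithin_le_nhds
    refine mem_closure_of_tendsto hlim ?_
    filter_upwards [self_mem_nhdsWithin] with s hs
    have hs' : 0 < s := hs
    obtain ⟨u, -, hu, -⟩ := exists_conic hΔ hpart p.2
    have hu' : weightClass u = p.2 := by rw [weightClass, finsum_eq_sum_of_fintype, hu]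
    -- Any lift `u` of `p.2` to the Cox variables serves; the signs reflect that weights are
    -- negatives of valuations.
    refine ⟨fun i => i.elim (-(p.1 + s)) fun r => -u r, ?_, ?_⟩
    · refine leadIdeal_family (disjoint_sectionExp_zero part) o fun j e he => ?_
      obtain ⟨m, rfl⟩ := (mem_support_genSection hΔ part j ha e).1 he
      have h1 := weight_sectionExp m.2.1 fun r => -u r
      simp only [Option.elim]
      rw [h1, weightClass_neg, hu', dotProduct_neg]
      linarith [hp j m]
    · simp only [Option.elim]
      rw [weightClass_neg, hu']
      ext <;> simp

/-! ### The Bergman fan -/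

section Bergman

theorem algebraMap_hahn (c : ℂ) : algebraMap ℂ (HahnSeries ℝ ℂ) c = HahnSeries.C c :=
  HahnSeries.ofPowerSeries_C c

theorem aeval_monomial_hahn {σ : Type*} [Fintype σ] (z : σ → HahnSeries ℝ ℂ) (e : σ →₀ ℕ) (c : ℂ) :
    aeval z (monomial e c) = HahnSeries.C c * ∏ r, z r ^ e r := by
  rw [aeval_monomial, Finsupp.prod_fintype _ _ (by simp), algebraMap_hahn]

theorem aeval_C_hahn {σ : Type*} (ζ : σ → ℂ) (f : MvPolynomial σ ℂ) :
    aeval (fun i => (HahnSeries.C (ζ i) : HahnSeries ℝ ℂ)) f = HahnSeries.C (aeval ζ f) := by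
  induction f using MvPolynomial.induction_on with
  | C a => rw [aeval_C, aeval_C, algebraMap_hahn]; rfl
  | add p q hp hq => rw [map_add, map_add, map_add, hp, hq]
  | mul_X p i hp => rw [map_mul, map_mul, map_mul, hp, aeval_X, aeval_X]

theorem prod_pow_ne_zero {σ : Type*} [Fintype σ] {z : σ → HahnSeries ℝ ℂ} (hz : ∀ i, z i ≠ 0)
    (e : σ → ℕ) : ∏ r, z r ^ e r ≠ 0 :=
  Finset.prod_ne_zero_iff.2 fun i _ => pow_ne_zero _ (hz i)

theorem order_prod_pow {σ : Type*} [Fintype σ] {z : σ → HahnSeries ℝ ℂ} (hz : ∀ i, z i ≠ 0)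
    (e : σ → ℕ) : (∏ r, z r ^ e r).order = ∑ r, (e r : ℝ) * (z r).order := by
  classical
  suffices h : ∀ s : Finset σ, (∏ r ∈ s, z r ^ e r).order = ∑ r ∈ s, (e r : ℝ) * (z r).order from
    h _
  intro s
  induction s using Finset.induction_on with
  | empty => simp
  | insert i s hi ih =>
    rw [Finset.prod_insert hi, Finset.sum_insert hi, HahnSeries.order_mul (pow_ne_zero _ (hz i))
      (Finset.prod_ne_zero_iff.2 fun i _ => pow_ne_zero _ (hz i)), ih, HahnSeries.order_pow,
      nsmul_eq_mul]

theorem prod_single_pow {σ : Type*} [Fintype σ] (u : σ → ℝ) (ξ : σ → ℂ) (e : σ → ℕ) :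
    ∏ r, (HahnSeries.single (u r) (ξ r)) ^ e r =
      HahnSeries.single (∑ r, (e r : ℝ) * u r) (∏ r, ξ r ^ e r) := by
  classical
  suffices h : ∀ s : Finset σ, ∏ r ∈ s, (HahnSeries.single (u r) (ξ r)) ^ e r =
      HahnSeries.single (∑ r ∈ s, (e r : ℝ) * u r) (∏ r ∈ s, ξ r ^ e r) from h _
  intro s
  induction s using Finset.induction_on with
  | empty => rfl
  | insert i s hi ih =>
    rw [Finset.prod_insert hi, Finset.sum_insert hi, Finset.prod_insert hi, ih,
      HahnSeries.single_pow, HahnSeries.single_mul_single, nsmul_eq_mul]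

/-- A point with complex coordinates can be found on every variety which has a point over the
field of Hahn series. -/
theorem zero_mem_bergmanFan {n : ℕ} {Q : Set (Fin n → ℝ)} [Fintype (Ray Q)] {I : Ideal (CoxT Q)}
    (h : (bergmanFan I).Nonempty) : (0 : ℝ × (Fin n → ℝ)) ∈ bergmanFan I := by
  obtain ⟨-, z, hz, hI, -⟩ := h
  -- Nullstellensatz: otherwise a power of the product of all variables lies in `I`, which the given
  -- Hahn point with nonzero coordinates excludes.
  obtain ⟨ζ, hζI, hζ⟩ : ∃ ζ ∈ zeroLocus ℂ I, ∀ i, ζ i ≠ 0 := by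
    by_contra! hno
    have hmem : (∏ i, X i : CoxT Q) ∈ I.radical := by
      rw [← vanishingIdeal_zeroLocus_eq_radical (K := ℂ)]
      intro ζ hζ
      obtain ⟨i, hi⟩ := hno ζ hζ
      rw [map_prod]
      exact Finset.prod_eq_zero (Finset.mem_univ i) (by rw [aeval_X, hi])
    obtain ⟨N, hN⟩ := hmem
    have h1 := hI _ hN
    rw [map_pow, map_prod] at h1
    simp only [aeval_X] at h1
    exact pow_ne_zero _ (Finset.prod_ne_zero_iff.2 fun i _ => hz i) h1
  refine ⟨fun i => HahnSeries.C (ζ i), fun i => HahnSeries.C_ne_zero (hζ i), fun f hf => ?_, ?_⟩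
  · rw [aeval_C_hahn, hζI f hf, map_zero]
  · simp only [weightClass, HahnSeries.order_C, zero_smul, finsum_zero]
    rfl

variable {n c : ℕ} {Δ : Set (Fin n → ℝ)}

theorem aeval_family [Fintype (Ray Δ)] (part : Ray Δ → Fin c) (a : CoeffIndex part → ℂ)
    (j : Fin c) [Fintype (FreeSection part j)] (z : Option (Ray Δ) → HahnSeries ℝ ℂ) :
    aeval z (X none * rename some (genSection part a j) +
        rename some (monomial (sectionExp part j 0) (1 : ℂ))) =
      (∑ m : FreeSection part j,
        HahnSeries.C (a ⟨j, m⟩) * (z none * ∏ r, z (some r) ^ sectionExp part j m.1 r)) +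
        ∏ r, z (some r) ^ sectionExp part j 0 r := by
  rw [map_add, map_mul, aeval_X, aeval_rename, aeval_rename, genSection_eq, map_sum,
    aeval_monomial_hahn, map_one, one_mul, Finset.mul_sum]
  congr 1
  refine Finset.sum_congr rfl fun m _ => ?_
  rw [aeval_monomial_hahn, mul_left_comm]
  rfl

/-- At a point of the Bergman fan in the free cone, some inequality of each block is an
equality. -/
theorem exists_tight_of_mem_bergmanFan (hΔ : IsReflexive Δ) {part : Ray Δ → Fin c}
    (hpart : IsNefPartition part) {a : CoeffIndex part → ℂ} {p : ℝ × (Fin n → ℝ)}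
    (hp : p ∈ freeCone part) (hB : p ∈ bergmanFan (familyIdeal part a)) (j : Fin c) :
    ∃ m : FreeSection part j, p.1 + toReal m.1 ⬝ᵥ p.2 = 0 := by
  have := hΔ.finite_ray
  have := Fintype.ofFinite (Ray Δ)
  have := finite_freeSection hΔ hpart j
  have := Fintype.ofFinite (FreeSection part j)
  obtain ⟨z, hz, hI, rfl⟩ := hB
  by_contra! hno
  rw [mem_freeCone] at hp
  have h1 := hI _ (by rw [familyIdeal_eq]; exact Ideal.subset_span ⟨j, rfl⟩)
  rw [aeval_family] at h1
  have hzs : ∀ r, z (some r) ≠ 0 := fun r => hz _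
  -- Without a tight section, every term of `t g_j` has strictly larger order than `m_j`, so the
  -- leading coefficient of `m_j` has nothing to cancel against.
  have h2 := congrArg (fun y => y.coeff (∏ r, z (some r) ^ sectionExp part j 0 r).order) h1
  simp only [HahnSeries.coeff_add, HahnSeries.coeff_zero, HahnSeries.coeff_sum] at h2
  rw [Finset.sum_eq_zero, zero_add, HahnSeries.coeff_order_eq_zero] at h2
  · exact prod_pow_ne_zero hzs _ h2
  · intro m _
    rw [HahnSeries.C_mul_eq_smul, HahnSeries.coeff_smul, HahnSeries.coeff_eq_zero_of_lt_order, smul_zero]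
    rw [HahnSeries.order_mul (hz _) (prod_pow_ne_zero hzs _), order_prod_pow hzs,
      order_prod_pow hzs, sum_sectionExp_mul m.2.1 fun r => (z (some r)).order]
    have h3 := lt_of_le_of_ne (hp j m) (Ne.symm (hno m))
    simp only at h3
    linarith

/-- Distinct sections have distinct monomials, so each partial sum is a nonzero polynomial, and so
is its product with the others and with all variables. The partial sums are the tight parts of the
`g_j`; their nonvanishing makes the lifted coordinates units. -/
theorem exists_nonvanishing (hΔ : IsReflexive Δ) {part : Ray Δ → Fin c} {a : CoeffIndex part → ℂ} (ha : ∀ i, a i ≠ 0)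
    [Fintype (Ray Δ)] [∀ j, Fintype (FreeSection part j)]
    (T : ∀ j, Finset (FreeSection part j)) (hT : ∀ j, (T j).Nonempty) :
    ∃ ξ : Ray Δ → ℂ, (∀ r, ξ r ≠ 0) ∧
      ∀ j, ∑ m ∈ T j, a ⟨j, m⟩ * ∏ r, ξ r ^ sectionExp part j m.1 r ≠ 0 := by
  classical
  let P : Fin c → Cox Δ := fun j => ∑ m ∈ T j, monomial (sectionExp part j m.1) (a ⟨j, m⟩)
  have hP : ∀ j, P j ≠ 0 := by
    intro j h
    obtain ⟨m, hm⟩ := hT j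
    have h1 := congrArg (coeff (sectionExp part j m.1)) h
    rw [coeff_sum, Finset.sum_eq_single_of_mem m hm, coeff_monomial, if_pos rfl, coeff_zero] at h1
    · exact ha _ h1
    · intro m' _ hne
      rw [coeff_monomial, if_neg]
      intro h
      exact hne (Subtype.ext (sectionExp_injOn hΔ part j m'.2.1 m.2.1 h))
  have hne : (∏ r, X r) * ∏ j, P j ≠ 0 :=
    mul_ne_zero (Finset.prod_ne_zero_iff.2 fun r _ => X_ne_zero r)
      (Finset.prod_ne_zero_iff.2 fun j _ => hP j)
  obtain ⟨ξ, hξ⟩ : ∃ ξ, eval ξ ((∏ r, X r) * ∏ j, P j) ≠ 0 := by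
    by_contra! hall
    exact hne (MvPolynomial.funext fun ξ => by rw [hall ξ, map_zero])
  rw [map_mul, map_prod, map_prod] at hξ
  refine ⟨ξ, fun r => ?_, fun j => ?_⟩
  · have := Finset.prod_ne_zero_iff.1 (left_ne_zero_of_mul hξ) r (Finset.mem_univ r)
    rwa [eval_X] at this
  · have := Finset.prod_ne_zero_iff.1 (right_ne_zero_of_mul hξ) j (Finset.mem_univ j)
    rw [map_sum] at this
    simpa only [eval_monomial, Finsupp.prod_fintype, pow_zero, implies_true] using this

/-- A point of the free cone lies in the Bergman fan if the initial forms at this point are, up to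
monomials, linear in suitable variables, one from each block. -/
theorem mem_bergmanFan (hΔ : IsReflexive Δ) {part : Ray Δ → Fin c}
    (hpart : IsNefPartition part) {a : CoeffIndex part → ℂ} (ha : ∀ i, a i ≠ 0)
    {p : ℝ × (Fin n → ℝ)} (hp : p ∈ freeCone part) (ρ : Fin c → Ray Δ)
    (hρ : ∀ j, part (ρ j) = j)
    (htight : ∀ j, ∃ m : FreeSection part j, p.1 + toReal m.1 ⬝ᵥ p.2 = 0)
    (hlin : ∀ j, ∀ m : FreeSection part j, p.1 + toReal m.1 ⬝ᵥ p.2 = 0 →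
      ∀ i, m.1 ⬝ᵥ (ρ i).gen + blockDivisor part j (ρ i) = 0) :
    p ∈ bergmanFan (familyIdeal part a) := by
  classical
  have := hΔ.finite_ray
  have := Fintype.ofFinite (Ray Δ)
  have := fun j => finite_freeSection hΔ hpart j
  have := fun j => Fintype.ofFinite (FreeSection part j)
  rw [mem_freeCone] at hp
  obtain ⟨u, -, hu, -⟩ := exists_conic hΔ hpart p.2
  have hu' : weightClass u = p.2 := by rw [weightClass, finsum_eq_sum_of_fintype, hu]
  obtain ⟨ξ, hξ0, hξ⟩ := exists_nonvanishing hΔ ha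
    (fun j => Finset.univ.filter fun m : FreeSection part j => p.1 + toReal m.1 ⬝ᵥ p.2 = 0)
    (fun j => by
      obtain ⟨m, hm⟩ := htight j
      exact ⟨m, by simpa using hm⟩)
  -- Substituting `x_r = ξ_r s ^ u_r` times an unknown and dividing by the monomial of `m_j` leaves
  -- the coefficients `b j m`, of valuation `p.1 + ⟨m, p.2⟩`. Tight sections become constants of the
  -- system, the others have positive valuation.
  let β : ∀ j, FreeSection part j → ℂ := fun j m =>
    -(a ⟨j, m⟩ * ∏ r, ξ r ^ sectionExp part j m.1 r) / ∏ r, ξ r ^ sectionExp part j 0 r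
  let b : ∀ j, FreeSection part j → HahnSeries ℝ ℂ := fun j m =>
    HahnSeries.single (p.1 + toReal m.1 ⬝ᵥ p.2) (β j m)
  have hξD : ∀ j, ∏ r, ξ r ^ sectionExp part j 0 r ≠ 0 := fun j =>
    Finset.prod_ne_zero_iff.2 fun r _ => pow_ne_zero _ (hξ0 r)
  have hbpos : ∀ j (m : FreeSection part j), p.1 + toReal m.1 ⬝ᵥ p.2 ≠ 0 → 0 < (b j m).orderTop := fun j m h =>
    HahnSeries.lt_orderTop_single (lt_of_le_of_ne (hp j m) (Ne.symm h))
  have hk0 : ∀ j (m : FreeSection part j), p.1 + toReal m.1 ⬝ᵥ p.2 = 0 →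
      (fun i => sectionExp part j m.1 (ρ i)) = 0 := fun j m h => by
    funext i
    have h1 := sectionExp_cast m.2.1 (ρ i)
    rw [hlin j m h i] at h1
    exact_mod_cast h1
  obtain ⟨μ, hμ, hμeq⟩ := exists_hahn_solution b (fun j m i => sectionExp part j m.1 (ρ i))
    (fun j m => le_trans (by exact_mod_cast hp j m) HahnSeries.orderTop_single_le)
    (fun j m => by
      by_cases h : p.1 + toReal m.1 ⬝ᵥ p.2 = 0
      · exact Or.inr (hk0 j m h)
      · exact Or.inl (hbpos j m h))
  have hμ0 : ∀ j, (μ j).coeff 0 ≠ 0 := by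
    intro j
    have hcoeff : (μ j).coeff 0 = ∑ m ∈ Finset.univ.filter
        (fun m : FreeSection part j => p.1 + toReal m.1 ⬝ᵥ p.2 = 0), β j m := by
      rw [hμeq j, HahnSeries.coeff_sum, Finset.sum_filter]
      refine Finset.sum_congr rfl fun m _ => ?_
      split_ifs with h
      · have h1 : ∏ i, μ i ^ sectionExp part j m.1 (ρ i) = 1 :=
          Finset.prod_eq_one fun i _ => by
            have := congrFun (hk0 j m h) i
            simp only [Pi.zero_apply] at this
            rw [this, pow_zero]
        rw [h1, mul_one]
        simp only [b]
        rw [h, HahnSeries.coeff_single_same]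
      · apply HahnSeries.coeff_eq_zero_of_lt_orderTop
        rw [HahnSeries.orderTop_mul]
        exact lt_of_lt_of_le (hbpos j m h) (le_add_of_nonneg_right
          (orderTop_prod_nonneg fun i _ => orderTop_pow_nonneg (hμ i) _))
    rw [hcoeff, ← Finset.sum_div, Finset.sum_neg_distrib]
    exact div_ne_zero (neg_ne_zero.2 (hξ j)) (hξD j)
  have hμne : ∀ j, μ j ≠ 0 := fun j h => hμ0 j (by rw [h]; rfl)
  have hμord : ∀ j, (μ j).order = 0 := fun j =>
    le_antisymm (HahnSeries.order_le_of_coeff_ne_zero (hμ0 j))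
      (HahnSeries.zero_le_orderTop_iff.1 (hμ j))
  -- Only one coordinate per block, that of `ρ j`, is corrected by an unknown; hence `m_j`
  -- contributes exactly the factor `μ j`.
  let ν : Ray Δ → HahnSeries ℝ ℂ := fun r => if r = ρ (part r) then μ (part r) else 1
  have hνne : ∀ r, ν r ≠ 0 := fun r => by
    simp only [ν]
    split_ifs
    · exact hμne _
    · exact one_ne_zero
  have hνord : ∀ r, (ν r).order = 0 := fun r => by
    simp only [ν]
    split_ifs
    · exact hμord _
    · exact HahnSeries.order_one
  have hνprod : ∀ e : Ray Δ → ℕ, ∏ r, ν r ^ e r = ∏ i, μ i ^ e (ρ i) := by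
    intro e
    rw [← Finset.prod_fiberwise (s := Finset.univ) (g := part)]
    refine Finset.prod_congr rfl fun i _ => ?_
    rw [Finset.prod_eq_single_of_mem (ρ i) (by simp [hρ])]
    · simp only [ν]
      rw [hρ, if_pos rfl]
    · intro r hr hne
      have hri : part r = i := by simpa using hr
      simp only [ν]
      rw [hri, if_neg hne, one_pow]
  let z : Option (Ray Δ) → HahnSeries ℝ ℂ := fun i =>
    i.elim (HahnSeries.single p.1 1) fun r => HahnSeries.single (u r) (ξ r) * ν r
  have hsingle : ∀ r, HahnSeries.single (u r) (ξ r) ≠ 0 := fun r =>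
    HahnSeries.single_ne_zero (hξ0 r)
  have hzprod : ∀ e : Ray Δ → ℕ, ∏ r, z (some r) ^ e r =
      HahnSeries.single (∑ r, (e r : ℝ) * u r) (∏ r, ξ r ^ e r) * ∏ i, μ i ^ e (ρ i) := by
    intro e
    simp only [z, Option.elim, mul_pow, Finset.prod_mul_distrib, prod_single_pow, hνprod]
  refine ⟨z, ?_, ?_, ?_⟩
  · rintro (_ | r)
    · exact HahnSeries.single_ne_zero one_ne_zero
    · exact mul_ne_zero (hsingle r) (hνne r)
  · have hle : familyIdeal part a ≤ RingHom.ker (aeval z : CoxT Δ →ₐ[ℂ] HahnSeries ℝ ℂ) := by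
      rw [familyIdeal_eq, Ideal.span_le]
      rintro _ ⟨j, rfl⟩
      rw [SetLike.mem_coe, RingHom.mem_ker, aeval_family]
      have hD : ∏ i, μ i ^ sectionExp part j 0 (ρ i) = μ j := by
        rw [Finset.prod_eq_single_of_mem j (Finset.mem_univ j)]
        · rw [sectionExp_zero_apply, if_pos (hρ j), pow_one]
        · intro i _ hij
          rw [sectionExp_zero_apply, if_neg (by rwa [hρ]), pow_zero]
      rw [hzprod, hD]
      conv_lhs => rw [hμeq j]
      rw [Finset.mul_sum, ← Finset.sum_add_distrib]
      refine Finset.sum_eq_zero fun m _ => ?_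
      have hbm : HahnSeries.C (a ⟨j, m⟩) * (z none *
          HahnSeries.single (∑ r, (sectionExp part j m.1 r : ℝ) * u r)
            (∏ r, ξ r ^ sectionExp part j m.1 r)) =
          -(HahnSeries.single (∑ r, (sectionExp part j 0 r : ℝ) * u r)
            (∏ r, ξ r ^ sectionExp part j 0 r) * b j m) := by
        simp only [z, b, Option.elim, β]
        rw [HahnSeries.single_mul_single, HahnSeries.single_mul_single,
          HahnSeries.C_apply, HahnSeries.single_mul_single, sum_sectionExp_mul m.2.1 u, hu',
          mul_div_cancel₀ _ (hξD j), ← HahnSeries.single_neg, neg_neg, one_mul]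
        congr 2
        ring
      rw [hzprod, ← mul_assoc, ← mul_assoc, ← mul_assoc, mul_assoc (HahnSeries.C _), hbm,
        ← add_mul, neg_add_cancel, zero_mul]
    exact fun f hf => hle hf
  · ext1
    · exact (HahnSeries.order_single one_ne_zero).symm
    · have hord : ∀ r, (z (some r)).order = u r := fun r => by
        simp only [z, Option.elim]
        rw [HahnSeries.order_mul (hsingle r) (hνne r), hνord, add_zero,
          HahnSeries.order_single (hξ0 r)]
      simp only [hord, hu']

end Bergman

/-! ### The mirror polytope -/

section Mirror

variable {n c : ℕ} {Δ : Set (Fin n → ℝ)}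

theorem mem_nabla {part : Ray Δ → Fin c} {w : Fin n → ℝ} : w ∈ nabla part ↔
    ∀ j, ∀ m ∈ sections (blockDivisor part j), -1 ≤ toReal m ⬝ᵥ w := by
  constructor
  · intro h j m hm
    exact h _ (subset_convexHull _ _ (Set.mem_iUnion.2 ⟨j, subset_convexHull _ _ ⟨m, hm, rfl⟩⟩))
  · intro h
    refine dotProduct_ge_on_convexHull fun x hx => ?_
    obtain ⟨j, hj⟩ := Set.mem_iUnion.1 hx
    refine dotProduct_ge_on_convexHull (V := toReal '' sections (blockDivisor part j)) ?_ x hj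
    rintro _ ⟨m, hm, rfl⟩
    exact h j m hm

theorem zero_mem_nabla (part : Ray Δ → Fin c) : (0 : Fin n → ℝ) ∈ nabla part :=
  mem_nabla.2 fun j m _ => by rw [dotProduct_zero]; norm_num

theorem nabla_eq_polyhedron (part : Ray Δ → Fin c) : nabla part =
    polyhedron (fun i : Σ j : Fin c, sections (blockDivisor part j) => dotForm (toReal i.2.1))
      fun _ => -1 := by
  ext w
  rw [mem_nabla]
  refine ⟨fun h i => ?_, fun h j m hm => ?_⟩
  · rw [dotForm_apply]
    exact h i.1 i.2.1 i.2.2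
  · rw [← dotForm_apply]
    exact h ⟨j, m, hm⟩

/-- A vector is *transversal* to the partition if all support functions of the `E_j` have the value
`1` there. -/
def IsTransversal (part : Ray Δ → Fin c) [Fintype (Ray Δ)] (w : Fin n → ℝ) : Prop :=
  ∃ l : Ray Δ → ℝ, (∀ r, 0 ≤ l r) ∧ ∑ r, l r • toReal r.gen = w ∧ ∀ j, blockMass part l j = 1

variable [Fintype (Ray Δ)] {part : Ray Δ → Fin c} {w : Fin n → ℝ}

/-- The hypothesis says that the Cox monomial of `m` is divisible by `m_k`. When all masses are at
least `1`, such a section cannot attain the minimum `-blockMass part l j`. -/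
theorem blockMass_sub_le {j k : Fin c} {m : Fin n → ℤ} {l : Ray Δ → ℝ} (hl : ∀ r, 0 ≤ l r)
    (hk : ∀ r, blockDivisor part k r ≤ m ⬝ᵥ r.gen + blockDivisor part j r) :
    blockMass part l k - blockMass part l j ≤ toReal m ⬝ᵥ (∑ r, l r • toReal r.gen) := by
  have h1 := dotProduct_add_blockMass part m l j
  have h2 : blockMass part l k ≤ ∑ r, l r * ((m ⬝ᵥ r.gen + blockDivisor part j r : ℤ) : ℝ) :=
    Finset.sum_le_sum fun r _ => mul_le_mul_of_nonneg_left (by exact_mod_cast hk r) (hl r)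
  linarith

/-- Tightness gives masses at least `1`. If the mass of block `j` exceeded `1`, the minimizing
section of `E_j` would violate its inequality if free, and would force a mass `≤ 0` by
`blockMass_sub_le` if not. -/
theorem isTransversal_of_free (hΔ : IsReflexive Δ) (hpart : IsNefPartition part)
    (hw : ∀ j, ∀ m : FreeSection part j, -1 ≤ toReal m.1 ⬝ᵥ w)
    (ht : ∀ j, ∃ m : FreeSection part j, toReal m.1 ⬝ᵥ w = -1) : IsTransversal part w := by
  obtain ⟨l, hl, rfl, hm⟩ := exists_conic hΔ hpart w
  have hge : ∀ j, 1 ≤ blockMass part l j := fun j => by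
    obtain ⟨m, hm⟩ := ht j
    have := neg_blockMass_le m.2.1 hl
    linarith
  refine ⟨l, hl, rfl, fun j => le_antisymm ?_ (hge j)⟩
  by_contra! hlt
  obtain ⟨m, hms, hmj⟩ := hm j
  by_cases hfree : sectionMonomial (blockDivisor part j) m ∈ specialIdeal part
  · obtain ⟨k, hk⟩ := exists_blockDivisor_le hms hfree
    have := blockMass_sub_le hl hk
    linarith [hge k]
  · have := hw j ⟨m, hms, hfree⟩
    simp only at this
    linarith

theorem isTransversal_of_mem_nabla (hΔ : IsReflexive Δ) (hpart : IsNefPartition part)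
    (hw : w ∈ nabla part)
    (ht : ∀ j, ∃ m ∈ sections (blockDivisor part j), toReal m ⬝ᵥ w = -1) :
    IsTransversal part w := by
  obtain ⟨l, hl, rfl, hm⟩ := exists_conic hΔ hpart w
  refine ⟨l, hl, rfl, fun j => le_antisymm ?_ ?_⟩
  · obtain ⟨m, hms, hmj⟩ := hm j
    linarith [mem_nabla.1 hw j m hms]
  · obtain ⟨m, hms, hmj⟩ := ht j
    linarith [neg_blockMass_le hms hl]

theorem IsTransversal.mem_nabla (h : IsTransversal part w) : w ∈ nabla part := by
  obtain ⟨l, hl, rfl, h1⟩ := h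
  refine TropMirror.mem_nabla.2 fun j m hm => ?_
  rw [← h1 j]
  exact neg_blockMass_le hm hl

/-- With all masses `1`, a section whose monomial lies in `I₀` has value at least `1 - 1 = 0`. -/
theorem IsTransversal.notMem_specialIdeal (h : IsTransversal part w) {j : Fin c} {m : Fin n → ℤ}
    (hm : m ∈ sections (blockDivisor part j)) (ht : toReal m ⬝ᵥ w = -1) :
    sectionMonomial (blockDivisor part j) m ∉ specialIdeal part := by
  obtain ⟨l, hl, rfl, h1⟩ := h
  intro hmem
  obtain ⟨k, hk⟩ := exists_blockDivisor_le hm hmem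
  have := blockMass_sub_le hl hk
  rw [h1, h1] at this
  linarith

/-- A block of mass `1` contains a ray with nonzero coefficient. For a tight section, a vanishing
sum of nonnegative terms shows that its Cox monomial avoids every such ray. -/
theorem IsTransversal.exists_rays (h : IsTransversal part w) :
    ∃ ρ : Fin c → Ray Δ, (∀ j, part (ρ j) = j) ∧
      ∀ j, ∀ m ∈ sections (blockDivisor part j), toReal m ⬝ᵥ w = -1 →
        ∀ i, m ⬝ᵥ (ρ i).gen + blockDivisor part j (ρ i) = 0 := by
  obtain ⟨l, hl, rfl, h1⟩ := h
  have hex : ∀ j, ∃ r, part r = j ∧ l r ≠ 0 := fun j => by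
    by_contra! hno
    have : blockMass part l j = 0 := Finset.sum_eq_zero fun r _ => by
      by_cases hr : part r = j
      · rw [hno r hr, zero_mul]
      · rw [blockDivisor, if_neg hr, Int.cast_zero, mul_zero]
    rw [h1] at this
    exact one_ne_zero this
  choose ρ hρ hlρ using hex
  refine ⟨ρ, hρ, fun j m hm ht i => ?_⟩
  have h2 := dotProduct_add_blockMass part m l j
  rw [ht, h1, neg_add_cancel, eq_comm, Finset.sum_eq_zero_iff_of_nonneg
    fun r _ => mul_nonneg (hl r) (by exact_mod_cast hm r)] at h2
  have h3 := (mul_eq_zero.1 (h2 (ρ i) (Finset.mem_univ _))).resolve_left (hlρ i)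
  exact_mod_cast h3

/-- The minimizing sections show that all block masses of `w` vanish, hence all its coefficients.
Geometrically, `∇` is bounded. -/
theorem eq_zero_of_sections_nonneg (hΔ : IsReflexive Δ) (hpart : IsNefPartition part)
    (hw : ∀ j, ∀ m ∈ sections (blockDivisor part j), 0 ≤ toReal m ⬝ᵥ w) : w = 0 := by
  obtain ⟨l, hl, rfl, hm⟩ := exists_conic hΔ hpart w
  refine Finset.sum_eq_zero fun r _ => ?_
  obtain ⟨m, hms, hmr⟩ := hm (part r)
  have h1 : l r * (blockDivisor part (part r) r : ℝ) ≤ blockMass part l (part r) :=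
    Finset.single_le_sum (f := fun r' => l r' * (blockDivisor part (part r) r' : ℝ))
      (fun r' _ => mul_nonneg (hl r') (by rw [blockDivisor]; split_ifs <;> simp))
      (Finset.mem_univ r)
  rw [blockDivisor, if_pos rfl, Int.cast_one, mul_one] at h1
  have h2 := hw _ m hms
  have h3 : l r = 0 := le_antisymm (by linarith) (hl r)
  rw [h3, zero_smul]

end Mirror

/-! ### Bipolar theorem -/

theorem polarDual_polarDual {n : ℕ} {K : Set (Fin n → ℝ)} (hc : IsClosed K) (hconv : Convex ℝ K)
    (h0 : (0 : Fin n → ℝ) ∈ K) : polarDual (polarDual K) = K := by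
  apply Set.Subset.antisymm
  · intro y hy
    by_contra hyK
    obtain ⟨f, u, hfK, hfy⟩ := geometric_hahn_banach_closed_point hconv hc hyK
    have hu : 0 < u := by simpa using hfK 0 h0
    let z : Fin n → ℝ := fun i => f (Pi.single i 1)
    have hz : ∀ x, x ⬝ᵥ z = f x := fun x => by
      conv_rhs => rw [pi_eq_sum_univ' x, map_sum]
      simp [dotProduct, z]
    have hmem : (-u⁻¹) • z ∈ polarDual K := by
      intro x hx
      rw [dotProduct_smul, hz, smul_eq_mul, neg_mul, neg_le_neg_iff, inv_mul_eq_div,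
        div_le_one hu]
      exact (hfK x hx).le
    have h1 := hy _ hmem
    rw [smul_dotProduct, dotProduct_comm, hz, smul_eq_mul, neg_mul, neg_le_neg_iff,
      inv_mul_eq_div, div_le_one hu] at h1
    linarith
  · intro y hy x hx
    rw [dotProduct_comm]
    exact hx y hy

theorem isExtreme_dotProduct_eq {n : ℕ} {K B : Set (Fin n → ℝ)}
    (h : ∀ x ∈ B, ∀ y ∈ K, -1 ≤ y ⬝ᵥ x) : IsExtreme ℝ K {y ∈ K | ∀ x ∈ B, y ⬝ᵥ x = -1} := by
  refine ⟨fun y hy => hy.1, ?_⟩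
  rintro y hy y' hy' z ⟨-, hz⟩ ⟨a, b, ha, hb, hab, rfl⟩
  refine ⟨hy, fun x hx => ?_⟩
  have h1 := hz x hx
  rw [add_dotProduct, smul_dotProduct, smul_dotProduct, smul_eq_mul, smul_eq_mul] at h1
  have h2 := h x hx y hy
  have h3 := h x hx y' hy'
  have h4 : a * (y ⬝ᵥ x + 1) = -(b * (y' ⬝ᵥ x + 1)) := by
    have : a + b - 1 = 0 := by linarith
    linear_combination h1 + this
  have h5 : 0 ≤ b * (y' ⬝ᵥ x + 1) := mul_nonneg hb.le (by linarith)
  nlinarith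

/-! ### Strata -/

/-- The point that is `0` on `A` and `1` elsewhere kills the ideal but not a product of variables
outside `A`. Finiteness matters because `∏ᶠ` over an infinite set of variables is `1`. -/
theorem prodVars_mem_span_X {n : ℕ} {Q : Set (Fin n → ℝ)} {J A : Set (Ray Q)} (hJ : J.Finite) :
    prodVars J ∈ Ideal.span (X '' A : Set (Cox Q)) ↔ ∃ r ∈ J, r ∈ A := by
  classical
  rw [prodVars, finprod_mem_eq_finite_toFinset_prod _ hJ]
  constructor
  · intro h
    have hle : Ideal.span (X '' A : Set (Cox Q)) ≤
        RingHom.ker (eval fun r => if r ∈ A then (0 : ℂ) else 1) := by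
      rw [Ideal.span_le]
      rintro _ ⟨r, hr, rfl⟩
      rw [SetLike.mem_coe, RingHom.mem_ker, eval_X, if_pos hr]
    have h1 := hle h
    rw [RingHom.mem_ker, map_prod, Finset.prod_eq_zero_iff] at h1
    obtain ⟨r, hr, h2⟩ := h1
    rw [eval_X] at h2
    exact ⟨r, hJ.mem_toFinset.1 hr, by by_contra hrA; simp [hrA] at h2⟩
  · rintro ⟨r, hr, hrA⟩
    exact Ideal.mem_of_dvd _ (Finset.dvd_prod_of_mem _ (hJ.mem_toFinset.2 hr))
      (Ideal.subset_span ⟨r, hrA, rfl⟩)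

section Strata

variable {n c : ℕ} {Δ : Set (Fin n → ℝ)} {part : Ray Δ → Fin c}

theorem convexHull_sectionPolytope (part : Ray Δ → Fin c) :
    convexHull ℝ (⋃ j, sectionPolytope (blockDivisor part j)) =
      convexHull ℝ (⋃ j, toReal '' sections (blockDivisor part j)) := by
  apply Set.Subset.antisymm
  · refine convexHull_min (Set.iUnion_subset fun j => ?_) (convex_convexHull _ _)
    exact convexHull_mono (Set.subset_iUnion (fun j => toReal '' sections (blockDivisor part j)) j)
  · exact convexHull_mono (Set.iUnion_mono fun j => subset_convexHull _ _)

theorem isCompact_sectionHull (hΔ : IsReflexive Δ) (hpart : IsNefPartition part) :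
    IsCompact (convexHull ℝ (⋃ j, sectionPolytope (blockDivisor part j))) := by
  rw [convexHull_sectionPolytope]
  exact (Set.finite_iUnion fun j => (finite_sections hΔ hpart j).image _).isCompact_convexHull ℝ

theorem zero_mem_sectionHull (part : Ray Δ → Fin c) (j : Fin c) :
    (0 : Fin n → ℝ) ∈ convexHull ℝ (⋃ j, sectionPolytope (blockDivisor part j)) := by
  rw [convexHull_sectionPolytope]
  exact subset_convexHull _ _ (Set.mem_iUnion.2
    ⟨j, 0, zero_mem_sections_blockDivisor part j, toReal_zero⟩)

/-- The index `j` ensures that the hull contains `0`; for `c = 0` it is empty. -/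
theorem polarDual_nabla (hΔ : IsReflexive Δ) (hpart : IsNefPartition part) (j : Fin c) :
    polarDual (nabla part) = convexHull ℝ (⋃ j, sectionPolytope (blockDivisor part j)) :=
  polarDual_polarDual (isCompact_sectionHull hΔ hpart).isClosed (convex_convexHull _ _)
    (zero_mem_sectionHull part j)

theorem exists_section_of_extreme {y : Fin n → ℝ}
    (hy : y ∈ (convexHull ℝ (⋃ j, sectionPolytope (blockDivisor part j))).extremePoints ℝ) :
    ∃ i, ∃ m ∈ sections (blockDivisor part i), toReal m = y := by
  rw [convexHull_sectionPolytope] at hy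
  obtain ⟨i, m, hm, rfl⟩ := Set.mem_iUnion.1 (extremePoints_convexHull_subset hy)
  exact ⟨i, m, hm, rfl⟩

theorem gen_mem_nablaPart (part : Ray Δ → Fin c) (r : Ray Δ) :
    toReal r.gen ∈ nablaPart part (part r) :=
  subset_convexHull _ _ (Or.inr ⟨r, rfl, rfl⟩)

theorem dotProduct_ge_on_nablaPart {j : Fin c} {y : Fin n → ℝ} {b : ℝ} (hb : b ≤ 0)
    (h : ∀ r, part r = j → b ≤ toReal r.gen ⬝ᵥ y) : ∀ w ∈ nablaPart part j, b ≤ w ⬝ᵥ y := by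
  apply dotProduct_ge_on_convexHull
  rintro _ (rfl | ⟨r, hr, rfl⟩)
  · rwa [zero_dotProduct]
  · exact h r hr

/-- The vertex of `∇^*` on the ray is `k` times the generator and is a section of some `E_i`. A ray
`q` of `J_j` where the generator is at most `-1` allows this only if `k = 1` and `E_i` has
coefficient `1` at `q`, that is `i = j`. -/
theorem gen_mem_sections_of_mem_mirrorBlock (hΔ : IsReflexive Δ) (hpart : IsNefPartition part)
    {j : Fin c} {r : Ray (nabla part)} (hr : r ∈ mirrorBlock part j) :
    r.gen ∈ sections (blockDivisor part j) ∧
      toReal r.gen ∈ (polarDual (nabla part)).extremePoints ℝ := by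
  obtain ⟨hp, α, hα, hext⟩ := r.2
  have hext' : α • toReal r.gen ∈
      (convexHull ℝ (⋃ j, sectionPolytope (blockDivisor part j))).extremePoints ℝ := by
    rw [← polarDual_nabla hΔ hpart j]
    exact hext
  obtain ⟨i, m, hm, hmr⟩ := exists_section_of_extreme hext'
  obtain ⟨k, hk, hαk, hmk⟩ := hp.exists_nsmul_of_smul_eq hα hmr.symm
  obtain ⟨⟨w, hw, hw1⟩, hlow⟩ := hr
  obtain ⟨q, hq, hq1⟩ : ∃ q : Ray Δ, part q = j ∧ q.gen ⬝ᵥ r.1 ≤ -1 := by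
    by_contra! hno
    have h1 := dotProduct_ge_on_nablaPart (part := part) (y := toReal r.gen) (b := 0) le_rfl
      (fun q hq => by
        have := hno q hq
        rw [toReal_dotProduct]
        exact_mod_cast (by simp only [Ray.gen] at this ⊢; omega : 0 ≤ q.gen ⬝ᵥ r.gen)) w hw
    simp only at hw1
    linarith
  have h2 : -(blockDivisor part i q) ≤ k * (q.gen ⬝ᵥ r.1) := by
    have := hm q
    rw [hmk, smul_dotProduct, nsmul_eq_mul, dotProduct_comm] at this
    linarith
  have h3 : (1 : ℤ) ≤ k := by exact_mod_cast hk
  have h4 : blockDivisor part i q ≤ 1 := by rw [blockDivisor]; split_ifs <;> norm_num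
  have h5 : (k : ℤ) ≤ blockDivisor part i q := by nlinarith
  have hk1 : k = 1 := by
    have : (k : ℤ) = 1 := by linarith
    exact_mod_cast this
  have hij : j = i := by
    rw [← hq]
    by_contra hne
    rw [blockDivisor, if_neg hne] at h5
    linarith
  subst hij
  rw [hk1, one_smul] at hmk
  rw [hαk, hk1, Nat.cast_one, one_smul] at hext
  rw [hmk] at hm
  exact ⟨hm, hext⟩

theorem finite_mirrorBlock (hΔ : IsReflexive Δ) (hpart : IsNefPartition part) (j : Fin c) :
    (mirrorBlock part j).Finite := by
  have h1 : Ray.gen '' mirrorBlock part j ⊆ sections (blockDivisor part j) := by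
    rintro _ ⟨r, hr, rfl⟩
    exact (gen_mem_sections_of_mem_mirrorBlock hΔ hpart hr).1
  exact ((finite_sections hΔ hpart j).subset h1).of_finite_image (Subtype.val_injective.injOn)

theorem dotProduct_eq_of_subset_facet (hΔ : IsReflexive Δ) (hpart : IsNefPartition part)
    {j : Fin c} {r : Ray (nabla part)} (hr : r ∈ mirrorBlock part j) {F : Set (Fin n → ℝ)}
    (hF : F ⊆ facet (nabla part) r) {x : Fin n → ℝ} (hx : x ∈ F) : toReal r.gen ⬝ᵥ x = -1 := by
  obtain ⟨hsec, hext⟩ := gen_mem_sections_of_mem_mirrorBlock hΔ hpart hr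
  obtain ⟨hxn, hmin⟩ := hF hx
  refine le_antisymm ?_ (mem_nabla.1 hxn j _ hsec)
  by_contra! hlt
  rw [dotProduct_comm] at hlt
  -- If `-1` were not attained, the vertex could be stretched by some `s > 1` within `∇^*` and would
  -- lie strictly between `0` and its multiple.
  obtain ⟨s, hs1, hs⟩ : ∃ s : ℝ, 1 < s ∧ -1 ≤ s * (x ⬝ᵥ toReal r.gen) := by
    by_cases h : 0 ≤ x ⬝ᵥ toReal r.gen
    · exact ⟨2, by norm_num, by linarith⟩
    · push Not at h
      refine ⟨(-(x ⬝ᵥ toReal r.gen))⁻¹, (one_lt_inv₀ (by linarith)).2 (by linarith), ?_⟩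
      rw [inv_neg, neg_mul, inv_mul_cancel₀ h.ne]
  have hmem : s • toReal r.gen ∈ polarDual (nabla part) := by
    intro y hy
    rw [dotProduct_smul, smul_eq_mul]
    exact hs.trans (mul_le_mul_of_nonneg_left (hmin y hy) (by linarith))
  have h0 : (0 : Fin n → ℝ) ∈ polarDual (nabla part) := fun y _ => by
    rw [dotProduct_zero]; norm_num
  have hs0 : 0 < s := by linarith
  have h1 := hext.2 hmem h0 ⟨s⁻¹, 1 - s⁻¹, by positivity,
    by linarith [inv_lt_one_of_one_lt₀ hs1], by ring, by
      rw [smul_zero, add_zero, smul_smul, inv_mul_cancel₀ hs0.ne', one_smul]⟩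
  have h2 : (s - 1) • toReal r.gen = 0 := by rw [sub_smul, one_smul, h1, sub_self]
  have h3 := (smul_eq_zero.1 h2).resolve_left (by linarith)
  exact r.2.1.ne_zero (toReal_injective (h3.trans toReal_zero.symm))

theorem exists_mirrorBlock_of_tight (hΔ : IsReflexive Δ) (hpart : IsNefPartition part)
    {F : Set (Fin n → ℝ)} (hF : F ⊆ nabla part) (hne : F.Nonempty)
    (ht : ∀ j, ∃ m ∈ sections (blockDivisor part j), ∀ x ∈ F, toReal m ⬝ᵥ x = -1) (j : Fin c) :
    ∃ r ∈ mirrorBlock part j, F ⊆ facet (nabla part) r := by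
  have := hΔ.finite_ray
  have := Fintype.ofFinite (Ray Δ)
  obtain ⟨w, hw⟩ := hne
  obtain ⟨ρ, hρ, hρm⟩ := (isTransversal_of_mem_nabla hΔ hpart (hF hw) fun j => by
    obtain ⟨m, hm, hmF⟩ := ht j
    exact ⟨m, hm, hmF w hw⟩).exists_rays
  set K := convexHull ℝ (⋃ j, sectionPolytope (blockDivisor part j)) with hK
  have hKcomp : IsCompact K := isCompact_sectionHull hΔ hpart
  -- Adding the generator of `ρ j` to `F` keeps the vertex found below in block `j`: among all
  -- sections, only those of `E_j` can take the value `-1` on it. That value also makes the vertex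
  -- primitive.
  set B : Set (Fin n → ℝ) := insert (toReal (ρ j).gen) F with hB
  have hBK : ∀ x ∈ B, ∀ y ∈ K, -1 ≤ y ⬝ᵥ x := by
    rintro x (rfl | hx)
    · rw [hK, convexHull_sectionPolytope]
      apply dotProduct_ge_on_convexHull
      intro y hy
      obtain ⟨i, m, hm, rfl⟩ := Set.mem_iUnion.1 hy
      have h1 := hm (ρ j)
      have h2 : blockDivisor part i (ρ j) ≤ 1 := by rw [blockDivisor]; split_ifs <;> norm_num
      rw [toReal_dotProduct]
      exact_mod_cast (by linarith : -1 ≤ m ⬝ᵥ (ρ j).gen)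
    · exact fun y hy => hF hx y hy
  have hGext := isExtreme_dotProduct_eq hBK
  have hGcomp : IsCompact {y ∈ K | ∀ x ∈ B, y ⬝ᵥ x = -1} := by
    have h1 : {y ∈ K | ∀ x ∈ B, y ⬝ᵥ x = -1} = K ∩ ⋂ x ∈ B, {y | y ⬝ᵥ x = -1} := by
      ext y; simp
    rw [h1]
    exact hKcomp.inter_right (isClosed_biInter fun x _ =>
      isClosed_eq (by unfold dotProduct; fun_prop) continuous_const)
  obtain ⟨m₀, hm₀, hm₀F⟩ := ht j
  have hGne : {y ∈ K | ∀ x ∈ B, y ⬝ᵥ x = -1}.Nonempty := by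
    refine ⟨toReal m₀, subset_convexHull _ _ (Set.mem_iUnion.2
      ⟨j, subset_convexHull _ _ ⟨m₀, hm₀, rfl⟩⟩), ?_⟩
    rintro x (rfl | hx)
    · have h1 := hρm j m₀ hm₀ (hm₀F w hw) j
      rw [blockDivisor, if_pos (hρ j)] at h1
      rw [toReal_dotProduct]
      exact_mod_cast (by linarith : m₀ ⬝ᵥ (ρ j).gen = -1)
    · exact hm₀F x hx
  obtain ⟨y, hy⟩ := hGcomp.extremePoints_nonempty hGne
  have hyK := hGext.extremePoints_subset_extremePoints hy
  obtain ⟨i, m, hm, rfl⟩ := exists_section_of_extreme hyK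
  have hyB := hy.1.2
  have hmρ : m ⬝ᵥ (ρ j).gen = -1 := by
    have := hyB _ (Set.mem_insert _ _)
    rw [toReal_dotProduct] at this
    exact_mod_cast this
  have hij : j = i := by
    have h1 := hm (ρ j)
    by_contra hne
    rw [blockDivisor, if_neg (by rwa [hρ]), hmρ] at h1
    linarith
  subst hij
  have hprim : IsPrimitive m := by
    intro k u hk
    rw [hk, smul_dotProduct, nsmul_eq_mul] at hmρ
    have : (k : ℤ) ∣ 1 := ⟨-(u ⬝ᵥ (ρ j).gen), by linarith⟩
    exact_mod_cast Int.eq_one_of_dvd_one (by positivity) this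
  refine ⟨⟨m, hprim, 1, one_pos, ?_⟩, ⟨⟨toReal (ρ j).gen, ?_, ?_⟩, ?_⟩, fun x hx => ⟨hF hx, fun z hz => ?_⟩⟩
  · rw [one_smul, polarDual_nabla hΔ hpart j]
    exact hyK
  · have := gen_mem_nablaPart part (ρ j)
    rwa [hρ] at this
  · have := hyB _ (Set.mem_insert _ _)
    exact (dotProduct_comm _ _).trans this
  · rintro _ ⟨z, hz, rfl⟩
    refine dotProduct_ge_on_nablaPart (by norm_num) (fun r hr => ?_) z hz
    have h1 := hm r
    rw [blockDivisor, if_pos hr] at h1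
    have h2 : -1 ≤ r.gen ⬝ᵥ m := by rw [dotProduct_comm]; linarith
    have h3 := toReal_dotProduct r.gen m
    change -1 ≤ toReal r.gen ⬝ᵥ toReal m
    rw [h3]
    exact_mod_cast h2
  · have h1 := hyB x (Set.mem_insert_of_mem _ hx)
    have h2 := mem_nabla.1 hz j m hm
    rw [dotProduct_comm] at h1 h2
    exact h1.trans_le h2

/-- The strata of the special fiber of the mirror are the faces of `∇` on which a section of each
`E_j` has the value `-1`. -/
theorem mem_strata_nabla (hΔ : IsReflexive Δ) (hpart : IsNefPartition part)
    (F : Set (Fin n → ℝ)) :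
    F ∈ strata (nabla part) (monomialIdeal (mirrorBlock part)) ↔
      IsProperFace (nabla part) F ∧
        ∀ j, ∃ m ∈ sections (blockDivisor part j), ∀ x ∈ F, toReal m ⬝ᵥ x = -1 := by
  have hideal : monomialIdeal (mirrorBlock part) ≤
      Ideal.span (X '' {r : Ray (nabla part) | F ⊆ facet (nabla part) r}) ↔
      ∀ j, ∃ r ∈ mirrorBlock part j, F ⊆ facet (nabla part) r := by
    rw [monomialIdeal, Ideal.span_le, Set.range_subset_iff]
    exact forall_congr' fun j => prodVars_mem_span_X (finite_mirrorBlock hΔ hpart j)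
  rw [strata, Set.mem_ofPred_eq, hideal]
  refine and_congr_right fun hF => ⟨fun h j => ?_, fun h j => ?_⟩
  · obtain ⟨r, hr, hrF⟩ := h j
    exact ⟨r.gen, (gen_mem_sections_of_mem_mirrorBlock hΔ hpart hr).1, fun x hx =>
      dotProduct_eq_of_subset_facet hΔ hpart hr hrF hx⟩
  · exact exists_mirrorBlock_of_tight hΔ hpart hF.1.subset hF.2.1 h j

end Strata

/-! ### Tropical faces of the free cone and strata of the mirror -/

section Main

variable {n c : ℕ} {Δ : Set (Fin n → ℝ)} {part : Ray Δ → Fin c}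

theorem mem_tightFace_freeCone {T : Set (CoeffIndex part)} {p : ℝ × (Fin n → ℝ)} :
    p ∈ tightFace (fun i : CoeffIndex part => coneForm (toReal i.2.1)) (fun _ => 0) T ↔
      p ∈ freeCone part ∧ ∀ i ∈ T, p.1 + toReal i.2.1 ⬝ᵥ p.2 = 0 := by
  simp only [tightFace, coneForm_apply]
  rfl

theorem mem_tightFace_nabla {T : Set (Σ j : Fin c, sections (blockDivisor part j))}
    {w : Fin n → ℝ} :
    w ∈ tightFace (fun i : Σ j : Fin c, sections (blockDivisor part j) => dotForm (toReal i.2.1))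
        (fun _ => -1) T ↔
      w ∈ nabla part ∧ ∀ i ∈ T, toReal i.2.1 ⬝ᵥ w = -1 := by
  rw [nabla_eq_polyhedron]
  simp only [tightFace, dotForm_apply]
  rfl

theorem finite_sigma_sections (hΔ : IsReflexive Δ) (hpart : IsNefPartition part) :
    Finite (Σ j : Fin c, sections (blockDivisor part j)) := by
  have := fun j => (finite_sections hΔ hpart j).to_subtype
  infer_instance

theorem finite_coeffIndex (hΔ : IsReflexive Δ) (hpart : IsNefPartition part) :
    Finite (CoeffIndex part) := by
  have := fun j => finite_freeSection hΔ hpart j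
  infer_instance

/-- A face of the free cone in the Bergman fan meets the hyperplane at height `1` in a stratum. -/
theorem isProperFace_nabla_of_freeCone (hΔ : IsReflexive Δ) (hpart : IsNefPartition part)
    {a : CoeffIndex part → ℂ} {C : Set (ℝ × (Fin n → ℝ))} (hC : IsProperFace (freeCone part) C)
    (hB : C ⊆ bergmanFan (familyIdeal part a)) (hne : {w | ((1 : ℝ), w) ∈ C}.Nonempty) :
    IsProperFace (nabla part) {w | ((1 : ℝ), w) ∈ C} ∧
      ∀ j, ∃ m ∈ sections (blockDivisor part j),
        ∀ x ∈ {w | ((1 : ℝ), w) ∈ C}, toReal m ⬝ᵥ x = -1 := by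
  have := hΔ.finite_ray
  have := Fintype.ofFinite (Ray Δ)
  have := finite_sigma_sections hΔ hpart
  have := finite_coeffIndex hΔ hpart
  obtain ⟨p₀, hp₀, hCT⟩ := exists_eq_tightFace hC.1 hC.2.1
  set T := {i : CoeffIndex part | coneForm (toReal i.2.1) p₀ = 0} with hT
  have hmem : ∀ p, p ∈ C ↔ p ∈ freeCone part ∧ ∀ i ∈ T, p.1 + toReal i.2.1 ⬝ᵥ p.2 = 0 := fun p => by
    rw [hCT]; exact mem_tightFace_freeCone
  have hblock : ∀ j, ∃ m : FreeSection part j, (⟨j, m⟩ : CoeffIndex part) ∈ T := fun j => by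
    obtain ⟨m, hm⟩ := exists_tight_of_mem_bergmanFan hΔ hpart ((hmem p₀).1 hp₀).1 (hB hp₀) j
    exact ⟨m, by rw [hT]; exact (coneForm_apply _ _).trans hm⟩
  have htight : ∀ w, ((1 : ℝ), w) ∈ C → ∀ i ∈ T, toReal i.2.1 ⬝ᵥ w = -1 := fun w hw i hi => by
    have := ((hmem _).1 hw).2 i hi
    simp only at this
    linarith
  have hsub : ∀ w, ((1 : ℝ), w) ∈ C → w ∈ nabla part := fun w hw => by
    refine (isTransversal_of_free hΔ hpart (fun j m => ?_) fun j => ?_).mem_nabla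
    · have := mem_freeCone.1 ((hmem _).1 hw).1 j m
      simp only at this
      linarith
    · obtain ⟨m, hm⟩ := hblock j
      exact ⟨m, htight w hw _ hm⟩
  have hF : {w | ((1 : ℝ), w) ∈ C} =
      tightFace (fun i : Σ j : Fin c, sections (blockDivisor part j) => dotForm (toReal i.2.1))
        (fun _ => -1) ((fun i : CoeffIndex part => ⟨i.1, i.2.1, i.2.2.1⟩) '' T) := by
    ext w
    rw [mem_tightFace_nabla]
    constructor
    · intro hw
      refine ⟨hsub w hw, ?_⟩
      rintro _ ⟨i, hi, rfl⟩
      exact htight w hw i hi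
    · rintro ⟨hw, hwT⟩
      refine (hmem _).2 ⟨mem_freeCone.2 fun j m => ?_, fun i hi => ?_⟩
      · have := mem_nabla.1 hw j m.1 m.2.1
        simp only
        linarith
      · have := hwT _ ⟨i, hi, rfl⟩
        simp only at this ⊢
        linarith
  refine ⟨⟨?_, hne, ?_⟩, fun j => ?_⟩
  · rw [hF, nabla_eq_polyhedron]
    exact isExposed_tightFace _ _ _
  · intro heq
    have hTne : T.Nonempty := by
      by_contra hTe
      rw [Set.not_nonempty_iff_eq_empty] at hTe
      apply hC.2.2
      ext p
      rw [hmem, hTe]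
      simp
    obtain ⟨i, hi⟩ := hTne
    -- All inequalities are strict at the origin of `∇`, so a face with a tight inequality misses
    -- it.
    have h0 : (0 : Fin n → ℝ) ∈ {w | ((1 : ℝ), w) ∈ C} := heq ▸ zero_mem_nabla part
    have := htight 0 h0 i hi
    rw [dotProduct_zero] at this
    norm_num at this
  · obtain ⟨m, hm⟩ := hblock j
    exact ⟨m.1, m.2.1, fun w hw => htight w hw _ hm⟩

/-- A face of the free cone lies in the Bergman fan if it has a point `(1, x₀)` and if an
inequality of each block is tight on it. -/
theorem tightFace_subset_bergmanFan (hΔ : IsReflexive Δ) (hpart : IsNefPartition part)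
    [Fintype (Ray Δ)] {a : CoeffIndex part → ℂ} (ha : ∀ i, a i ≠ 0) {T : Set (CoeffIndex part)}
    (hblock : ∀ j, ∃ m : FreeSection part j, (⟨j, m⟩ : CoeffIndex part) ∈ T) {x₀ : Fin n → ℝ}
    (hx₀ : ((1 : ℝ), x₀) ∈
      tightFace (fun i : CoeffIndex part => coneForm (toReal i.2.1)) (fun _ => 0) T) :
    tightFace (fun i : CoeffIndex part => coneForm (toReal i.2.1)) (fun _ => 0) T ⊆
      bergmanFan (familyIdeal part a) := by
  set C := tightFace (fun i : CoeffIndex part => coneForm (toReal i.2.1)) (fun _ => (0 : ℝ)) T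
    with hC
  have hcomb : ∀ p ∈ C, ∀ q ∈ C, ∀ s t : ℝ, 0 ≤ s → 0 ≤ t → s • p + t • q ∈ C := by
    intro p hp q hq s t hs ht
    refine ⟨fun i => ?_, fun i hi => ?_⟩
    · rw [map_add, map_smul, map_smul, smul_eq_mul, smul_eq_mul]
      exact add_nonneg (mul_nonneg hs (hp.1 i)) (mul_nonneg ht (hq.1 i))
    · rw [map_add, map_smul, map_smul, hp.2 i hi, hq.2 i hi]
      simp
  have htrans : ∀ w, ((1 : ℝ), w) ∈ C → IsTransversal part w := fun w hw => by
    rw [hC, mem_tightFace_freeCone] at hw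
    refine isTransversal_of_free hΔ hpart (fun j m => ?_) fun j => ?_
    · have := mem_freeCone.1 hw.1 j m
      simp only at this
      linarith
    · obtain ⟨m, hm⟩ := hblock j
      have := hw.2 _ hm
      simp only at this
      exact ⟨m, by linarith⟩
  have hpos : ∀ p ∈ C, 0 < p.1 → p ∈ bergmanFan (familyIdeal part a) := by
    intro p hp h0
    have h1 : ((1 : ℝ), p.1⁻¹ • p.2) ∈ C := by
      have h2 := hcomb p hp p hp p.1⁻¹ 0 (inv_nonneg.2 h0.le) le_rfl
      have h3 : p.1⁻¹ • p + (0 : ℝ) • p = ((1 : ℝ), p.1⁻¹ • p.2) := by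
        rw [zero_smul, add_zero]
        ext1
        · exact inv_mul_cancel₀ h0.ne'
        · rfl
      rwa [h3] at h2
    obtain ⟨ρ, hρ, hρm⟩ := (htrans _ h1).exists_rays
    have hp' := mem_tightFace_freeCone.1 hp
    refine mem_bergmanFan hΔ hpart ha hp'.1 ρ hρ (fun j => ?_) fun j m hm => ?_
    · obtain ⟨m, hm⟩ := hblock j
      exact ⟨m, hp'.2 _ hm⟩
    · refine hρm j m.1 m.2.1 ?_
      rw [dotProduct_smul, smul_eq_mul, inv_mul_eq_div, div_eq_iff h0.ne']
      linarith
  -- The slice of `C` at height 1 lies in the bounded polytope `∇`, so it has no recession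
  -- directions.
  have hrec : ∀ v, ((0 : ℝ), v) ∈ C → v = 0 := by
    intro v hv
    refine eq_zero_of_sections_nonneg hΔ hpart fun j m hm => ?_
    by_contra! hneg
    have hall : ∀ s : ℝ, 0 ≤ s → -1 ≤ toReal m ⬝ᵥ x₀ + s * (toReal m ⬝ᵥ v) := fun s hs => by
      have h1 := hcomb _ hx₀ _ hv 1 s zero_le_one hs
      have h2 : (1 : ℝ) • ((1 : ℝ), x₀) + s • ((0 : ℝ), v) = ((1 : ℝ), x₀ + s • v) := by
        ext1 <;> simp
      rw [h2] at h1
      have h3 := mem_nabla.1 (htrans _ h1).mem_nabla j m hm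
      rwa [dotProduct_add, dotProduct_smul, smul_eq_mul] at h3
    have hx := hall 0 le_rfl
    rw [zero_mul, add_zero] at hx
    -- The parameter is chosen so that the value of `m` becomes `-2`.
    have h1 := hall ((2 + toReal m ⬝ᵥ x₀) / -(toReal m ⬝ᵥ v))
      (div_nonneg (by linarith) (by linarith))
    rw [div_mul_eq_mul_div, div_neg, mul_div_cancel_right₀ _ hneg.ne] at h1
    linarith
  intro p hp
  -- At negative height `p` is a multiple of `(1, x₀)`, and the rays `ρ` found at `x₀` serve for `p`
  -- as well. At height 0 only the apex is left; there every section is tight and a complex point is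
  -- used instead.
  rcases lt_trichotomy p.1 0 with h | h | h
  · have h1 := hcomb p hp _ hx₀ 1 (-p.1) zero_le_one (by linarith)
    have h2 : (1 : ℝ) • p + (-p.1) • ((1 : ℝ), x₀) = ((0 : ℝ), p.2 - p.1 • x₀) := by
      ext1
      · simp
      · simp [sub_eq_add_neg]
    rw [h2] at h1
    have hw : p.2 = p.1 • x₀ := sub_eq_zero.1 (hrec _ h1)
    obtain ⟨ρ, hρ, hρm⟩ := (htrans _ hx₀).exists_rays
    have hp' := mem_tightFace_freeCone.1 hp
    refine mem_bergmanFan hΔ hpart ha hp'.1 ρ hρ (fun j => ?_) fun j m hm => ?_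
    · obtain ⟨m, hm⟩ := hblock j
      exact ⟨m, hp'.2 _ hm⟩
    · refine hρm j m.1 m.2.1 ?_
      rw [hw, dotProduct_smul, smul_eq_mul] at hm
      have h3 : p.1 * (toReal m.1 ⬝ᵥ x₀ + 1) = 0 := by linarith
      have h4 := (mul_eq_zero.1 h3).resolve_left h.ne
      linarith
  · have h1 : p = 0 := by
      ext1
      · exact h
      · exact hrec _ (by rw [← h]; exact hp)
    rw [h1]
    exact zero_mem_bergmanFan ⟨_, hpos _ hx₀ one_pos⟩
  · exact hpos p hp h

/-- Every stratum is the intersection of a tropical face of the free cone with the hyperplane at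
height `1`. -/
theorem exists_face_freeCone_of_nabla (hΔ : IsReflexive Δ) (hpart : IsNefPartition part)
    {a : CoeffIndex part → ℂ} (ha : ∀ i, a i ≠ 0) {F : Set (Fin n → ℝ)}
    (hF : IsProperFace (nabla part) F)
    (ht : ∀ j, ∃ m ∈ sections (blockDivisor part j), ∀ x ∈ F, toReal m ⬝ᵥ x = -1) :
    ∃ C, IsProperFace (freeCone part) C ∧ C ⊆ bergmanFan (familyIdeal part a) ∧
      F = {w | ((1 : ℝ), w) ∈ C} := by
  have := hΔ.finite_ray
  have := Fintype.ofFinite (Ray Δ)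
  have := finite_sigma_sections hΔ hpart
  have := finite_coeffIndex hΔ hpart
  have hexp := hF.1
  rw [nabla_eq_polyhedron] at hexp
  obtain ⟨x₀, hx₀, hFT⟩ := exists_eq_tightFace hexp hF.2.1
  set T₀ := {i : Σ j : Fin c, sections (blockDivisor part j) | dotForm (toReal i.2.1) x₀ = -1}
    with hT₀
  have hT₀mem : ∀ i, i ∈ T₀ ↔ toReal i.2.1 ⬝ᵥ x₀ = -1 := fun i => by
    rw [hT₀, Set.mem_ofPred_eq, dotForm_apply]
  have hmem : ∀ w, w ∈ F ↔ w ∈ nabla part ∧ ∀ i ∈ T₀, toReal i.2.1 ⬝ᵥ w = -1 := fun w => by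
    rw [← mem_tightFace_nabla, ← hFT]
  have htr : IsTransversal part x₀ :=
    isTransversal_of_mem_nabla hΔ hpart ((hmem x₀).1 hx₀).1 fun j => by
      obtain ⟨m, hm, hmF⟩ := ht j
      exact ⟨m, hm, hmF _ hx₀⟩
  -- Since `x₀` is transversal, passing to free sections loses none of the equalities that define
  -- `F`.
  let T : Set (CoeffIndex part) := {i | toReal i.2.1 ⬝ᵥ x₀ = -1}
  have hfree : ∀ i : Σ j : Fin c, sections (blockDivisor part j), i ∈ T₀ →
      ∃ h, (⟨i.1, i.2.1, h⟩ : CoeffIndex part) ∈ T := fun i hi =>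
    ⟨⟨i.2.2, htr.notMem_specialIdeal i.2.2 ((hT₀mem i).1 hi)⟩, (hT₀mem i).1 hi⟩
  have hblock : ∀ j, ∃ m : FreeSection part j, (⟨j, m⟩ : CoeffIndex part) ∈ T := fun j => by
    obtain ⟨m, hm, hmF⟩ := ht j
    obtain ⟨h, hT⟩ := hfree ⟨j, m, hm⟩ ((hT₀mem _).2 (hmF _ hx₀))
    exact ⟨_, hT⟩
  have hslice : ∀ w, w ∈ F ↔ ((1 : ℝ), w) ∈
      tightFace (fun i : CoeffIndex part => coneForm (toReal i.2.1)) (fun _ => 0) T := by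
    intro w
    rw [hmem, mem_tightFace_freeCone, mem_freeCone]
    constructor
    · rintro ⟨hw, hwT⟩
      refine ⟨fun j m => by linarith [mem_nabla.1 hw j m.1 m.2.1], fun i hi => ?_⟩
      have := hwT ⟨i.1, i.2.1, i.2.2.1⟩ ((hT₀mem _).2 hi)
      simp only at this ⊢
      linarith
    · rintro ⟨hw, hwT⟩
      refine ⟨(isTransversal_of_free hΔ hpart (fun j m => by linarith [hw j m])
        fun j => ?_).mem_nabla, fun i hi => ?_⟩
      · obtain ⟨m, hm⟩ := hblock j
        have := hwT _ hm
        simp only at this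
        exact ⟨m, by linarith⟩
      · obtain ⟨h, hiT⟩ := hfree i hi
        have := hwT _ hiT
        simp only at this
        linarith
  have hx₀C := (hslice x₀).1 hx₀
  refine ⟨_, ⟨isExposed_tightFace _ _ T, ⟨_, hx₀C⟩, ?_⟩,
    tightFace_subset_bergmanFan hΔ hpart ha hblock hx₀C, Set.ext hslice⟩
  intro heq
  have hTne : T₀.Nonempty := by
    by_contra hTe
    rw [Set.not_nonempty_iff_eq_empty] at hTe
    apply hF.2.2
    ext w
    rw [hmem, hTe]
    simp
  obtain ⟨i, hi⟩ := hTne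
  obtain ⟨h, hiT⟩ := hfree i hi
  have h1 : ((1 : ℝ), (0 : Fin n → ℝ)) ∈ freeCone part :=
    mem_freeCone.2 fun j m => by simp
  have h2 := (mem_tightFace_freeCone.1 (heq.symm ▸ h1)).2 _ hiT
  simp at h2

end Main

end TropMirror

end

theorem mainTheorem2 (n c : ℕ) (Δ : Set (Fin n → ℝ)) (hΔ : TropMirror.IsReflexive Δ)
    (part : TropMirror.Ray Δ → Fin c) (hpart : TropMirror.IsNefPartition part) :
    ∃ Φ : MvPolynomial (TropMirror.CoeffIndex part) ℂ, Φ ≠ 0 ∧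
      ∀ a : TropMirror.CoeffIndex part → ℂ, MvPolynomial.eval a Φ ≠ 0 →
        ∀ o : TropMirror.MonomialOrdering (Option (TropMirror.Ray Δ)), o.IsLocalAt →
          TropMirror.strata (TropMirror.nabla part)
              (TropMirror.monomialIdeal (TropMirror.mirrorBlock part)) =
            TropMirror.specialFiberTropical o (TropMirror.familyIdeal part a)
              (TropMirror.specialIdeal part) := by
  have := TropMirror.finite_coeffIndex hΔ hpart
  have := Fintype.ofFinite (TropMirror.CoeffIndex part)
  -- The genericity polynomial is the product of all coefficients.
  refine ⟨∏ i, MvPolynomial.X i, Finset.prod_ne_zero_iff.2 fun i _ => MvPolynomial.X_ne_zero i,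
    fun a hΦ o _ => ?_⟩
  have ha : ∀ i, a i ≠ 0 := fun i => by
    rw [map_prod] at hΦ
    simpa using Finset.prod_ne_zero_iff.1 hΦ i (Finset.mem_univ i)
  ext F
  rw [TropMirror.mem_strata_nabla hΔ hpart, TropMirror.specialFiberTropical,
    TropMirror.specialFiberCone_eq hΔ hpart ha o]
  constructor
  · rintro ⟨hF, ht⟩
    exact ⟨hF.2.1, TropMirror.exists_face_freeCone_of_nabla hΔ hpart ha hF ht⟩
  · rintro ⟨hne, C, hC, hB, rfl⟩
    exact TropMirror.isProperFace_nabla_of_freeCone hΔ hpart hC hB hne
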